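/- Let $n\ge 0$, let $\mathbb C[x]=\mathbb C[x_{ij}\mid 1\le i<j\le n]$, write $x_{ji}=x_{ij}$, and let $I_n$ be the kernel of the $\mathbb C$-algebra homomorphism $\phi_n:\mathbb C[x]\to\mathbb C[t_1,\dots,t_n]$, $x_{ij}\mapsto t_it_j$ (the toric ideal of the second hypersimplex). Let $I_n^{(2)}$ be the symbolic square of the prime ideal $I_n$, that is, the contraction to $\mathbb C[x]$ of $I_n^2$ extended to the localization $\mathbb C[x]_{I_n}$. Let $I_n^{\{2\}}$ be the secant ideal of $I_n$, that is, the set of all $f\in\mathbb C[x]$ such that $f(y+z)\in I_n(y)+I_n(z)$ in $\mathbb C[y,z]$, where $y=(y_{ij})$, $z=(z_{ij})$ are two copies of the variables. Place the vertices $1,\dots,n$ in order at the corners of a regular $n$-gon. The class of the variable $x_{ij}$ is the orbit of the edge $ij$ under the dihedral group; classes are ordered by $\min(j-i,\,n-(j-i))$ for $i<j$. A term order $\prec$ is *circular* if it is a block (product) order whose blocks of variables are the classes, with variables of a smaller class larger: two monomials are compared by their parts in the first block in which they differ, starting from the smallest class (with an arbitrary term order inside each block). A $d\times d$ *off-diagonal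 minor* is a $d\times d$ minor of the symmetric matrix $(x_{ij})$ whose row set and column set are disjoint. A *degree-3 master polynomial* is given by six distinct vertices $i_1,j_1,i_2,j_2,i_3,j_3$ that occur in this cyclic order going once around the $n$-gon (starting at any vertex); it is $$f_{\mathbf i,\mathbf j}=\sum_{\sigma\in Z}\operatorname{sgn}(\sigma)\prod_{l=1}^{3}x_{\sigma(i_l)\,\sigma(j_l)},$$ where $Z$ is the group generated by the three transpositions $(i_l\ j_{l-1})$, with the index $l-1$ taken modulo $3$. Then, for any circular term order, the $3\times3$ off-diagonal minors, the degree-3 master polynomials and the products $gh$ of two (possibly equal) $2\times2$ off-diagonal minors $g,h$ form a Gröbner basis of $I_n^{(2)}$: they are a finite subset of $I_n^{(2)}$, and their leading terms generate the initial ideal of $I_n^{(2)}$. Moreover $$I_n^{(2)}=I_n^2+I_n^{\{2\}}.$$ -/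

import Mathlib

noncomputable section

namespace Hypersimplex

open MvPolynomial

/-! ### General notions from commutative algebra -/

/-- The `r`-th symbolic power `I^{(r)}`: the intersection, over the minimal primes `P` of `I`, of
the contractions to `R` of the extensions of `I ^ r` to the localization `R_P`. For a prime
ideal `I` this is the contraction of `I ^ r R_I`. -/
def symbolicPower {R : Type*} [CommRing R] (I : Ideal R) (r : ℕ) : Ideal R :=
  ⨅ P : I.minimalPrimes,
    haveI : P.1.IsPrime := P.2.1.1
    ((I ^ r).map (algebraMap R (Localization.AtPrime P.1))).comap
      (algebraMap R (Localization.AtPrime P.1))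

/-- The `r`-th secant ideal `I^{\{r\}}`, the `r`-fold join of `I` with itself: eliminate `y` from
`I(y₁) + ⋯ + I(y_r) + ⟨x_s - y₁ₛ - ⋯ - y_rₛ | s ∈ σ⟩`. Thus `f ∈ I^{\{r\}}` if and only if
`f(y₁ + ⋯ + y_r)` lies in the ideal `I(y₁) + ⋯ + I(y_r)` of the polynomial ring in the variables
`y_{k,s}`, where `I(y_k)` is the copy of `I` in the `k`-th block of variables. -/
def secantIdeal {K σ : Type*} [Field K] (I : Ideal (MvPolynomial σ K)) (r : ℕ) :
    Ideal (MvPolynomial σ K) :=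
  (⨆ k : Fin r, I.map (rename (R := K) fun s : σ => (k, s))).comap
    (aeval (R := K) fun s : σ => ∑ k : Fin r, (X (k, s) : MvPolynomial (Fin r × σ) K))

/-- `G` is a Gröbner basis of the ideal `I` with respect to the term order `m`: a finite subset
of `I` whose leading terms generate the initial ideal of `I`. -/
def IsGroebnerBasis {K σ : Type*} [Field K] (m : MonomialOrder σ)
    (G : Set (MvPolynomial σ K)) (I : Ideal (MvPolynomial σ K)) : Prop :=
  G.Finite ∧ G ⊆ (I : Set (MvPolynomial σ K)) ∧
    Ideal.span (m.leadingTerm '' G) =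
      Ideal.span (m.leadingTerm '' (I : Set (MvPolynomial σ K)))

/-- `m` is a block term order (product order) for the blocks of variables `{s | b s = c}`, the
blocks being compared in the order of increasing `c`: two monomials are compared by their parts in
the first block on which they differ. (The term order within a block is the restriction of `m`.) -/
def IsBlockOrder {σ : Type*} (b : σ → ℕ) (m : MonomialOrder σ) : Prop :=
  ∀ (c : ℕ) (u v : σ →₀ ℕ), (∀ s, b s < c → u s = v s) →
    m.toSyn (u.filter fun s => b s = c) < m.toSyn (v.filter fun s => b s = c) →
    m.toSyn u < m.toSyn v

/-! ### The second hypersimplex and circular term orders -/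

/-- The edges `ij`, `i < j`, of the complete graph on the vertices `Fin n`. -/
abbrev Edge (n : ℕ) : Type := {e : Fin n × Fin n // e.1 < e.2}

/-- The polynomial ring `ℂ[x_{ij} | i < j]`. -/
abbrev EdgeRing (n : ℕ) : Type := MvPolynomial (Edge n) ℂ

/-- The map `φ_n : ℂ[x] → ℂ[t]`, `x_{ij} ↦ t_i t_j`. -/
def phi (n : ℕ) : EdgeRing n →ₐ[ℂ] MvPolynomial (Fin n) ℂ :=
  aeval fun e : Edge n => X e.1.1 * X e.1.2

/-- The toric ideal `I_n = ker φ_n` of the second hypersimplex. -/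
def toricIdeal (n : ℕ) : Ideal (EdgeRing n) := RingHom.ker (phi n)

/-- The class of an edge `ij` in the circular drawing of `K_n` (vertices placed in order at the
corners of a regular `n`-gon): the number of sides of the polygon that the edge cuts off on its
shorter side. Two edges have the same value if and only if they are equivalent under the dihedral
group of the polygon, and the value is small for edges close to the boundary. -/
def edgeClass {n : ℕ} (e : Edge n) : ℕ :=
  min ((e.1.2 : ℕ) - (e.1.1 : ℕ)) (n - ((e.1.2 : ℕ) - (e.1.1 : ℕ)))

/-- A circular term order: a block term order whose blocks are the classes of edges, the variables
of a smaller class being larger. -/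
def IsCircular {n : ℕ} (m : MonomialOrder (Edge n)) : Prop :=
  IsBlockOrder edgeClass m

/-- In a circular term order a variable of smaller class is larger. -/
theorem IsCircular.single_lt {n : ℕ} {m : MonomialOrder (Edge n)} (hm : IsCircular m)
    {e f : Edge n} (h : edgeClass e < edgeClass f) :
    m.toSyn (Finsupp.single f 1) < m.toSyn (Finsupp.single e 1) := by
  refine hm (edgeClass e) _ _ (fun s hs => ?_) ?_
  · rw [Finsupp.single_apply, Finsupp.single_apply, if_neg, if_neg]
    · rintro rfl
      exact lt_irrefl _ hs
    · rintro rfl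
      exact lt_asymm h hs
  · have h1 : (Finsupp.single f 1 : Edge n →₀ ℕ).filter (fun s => edgeClass s = edgeClass e) = 0 :=
      Finsupp.filter_single_of_neg (fun s => edgeClass s = edgeClass e) h.ne'
    have h2 : (Finsupp.single e 1 : Edge n →₀ ℕ).filter (fun s => edgeClass s = edgeClass e) =
        Finsupp.single e 1 :=
      Finsupp.filter_single_of_pos (fun s => edgeClass s = edgeClass e) rfl
    rw [h1, h2, map_zero,
      MonomialOrder.toSyn_lt_iff_ne_zero, ne_eq, MonomialOrder.toSyn_eq_zero_iff]
    simp

/-! ### The polynomials -/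

/-- The entry `x_{ij} = x_{ji}`, `i ≠ j`, of the generic symmetric matrix. There are no diagonal
variables; the value at `i = j` is never used below. -/
def edgeVar {n : ℕ} (i j : Fin n) : EdgeRing n :=
  if h : i < j then X ⟨(i, j), h⟩ else if h : j < i then X ⟨(j, i), h⟩ else 0

/-- The `d × d` off-diagonal minors: the minors of the generic symmetric matrix `(x_{ij})` with
disjoint sets of rows and columns. -/
def offDiagonalMinors (n d : ℕ) : Set (EdgeRing n) :=
  {f | ∃ r c : Fin d ↪o Fin n, (∀ a b, r a ≠ c b) ∧
    f = (Matrix.of fun a b => edgeVar (r a) (c b)).det}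

/-- `(i, j)` is an admissible pair of sequences of length `2k+1`, with `l`-th entries indexed by
`l = 0, …, 2k` modulo `2k+1`: `i_0 ≤ j_0 < i_1 ≤ j_1 < ⋯ < i_{2k} ≤ j_{2k} < i_0` on the circle,
going around exactly once. Here `(x - i 0 : Fin n)` is the distance from `i_0` to `x` in the positive
direction around the circle. The last clause says that the pair admits the monomial
`∏ x_{i_l j_{l+k-1}}`, that is, none of its factors is on the diagonal (for `k = 1` this means
`i_l ≠ j_l` for all `l`, for `k ≥ 2` it is automatic). -/
def Admissible {n k : ℕ} (i j : ZMod (2 * k + 1) → Fin n) : Prop :=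
  (∀ l, (i l - i 0 : Fin n) ≤ (j l - i 0 : Fin n)) ∧
  (∀ l l', l.val < l'.val → (j l - i 0 : Fin n) < (i l' - i 0 : Fin n)) ∧
  ∀ l, i l ≠ j (l + (k : ZMod (2 * k + 1)) - 1)

/-- The letters `i_l` (`Sum.inl l`) and `j_l` (`Sum.inr l`), `l` modulo `2k+1`. -/
abbrev Letter (k : ℕ) : Type := ZMod (2 * k + 1) ⊕ ZMod (2 * k + 1)

/-- The group `Z_{i,j}` generated by the transpositions `(i_l j_{l-1})`. -/
def transpositionGroup (k : ℕ) : Subgroup (Equiv.Perm (Letter k)) :=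
  Subgroup.closure (Set.range fun l : ZMod (2 * k + 1) =>
    Equiv.swap (Sum.inl l : Letter k) (Sum.inr (l - 1)))

/-- The monomial `x_{i,j}^σ` of the fixed point free involution
`σ (∏ (i_l j_{l+k-1})) σ⁻¹ = ∏ (σ(i_l) σ(j_{l+k-1}))`. -/
def conjMonomial {n k : ℕ} (i j : ZMod (2 * k + 1) → Fin n) (σ : Equiv.Perm (Letter k)) :
    EdgeRing n :=
  ∏ l : ZMod (2 * k + 1), edgeVar (Sum.elim i j (σ (Sum.inl l)))
    (Sum.elim i j (σ (Sum.inr (l + (k : ZMod (2 * k + 1)) - 1))))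

open Classical in
/-- The master polynomial `f_{i,j} = ∑_{σ ∈ Z_{i,j}} (-1)^σ x_{i,j}^σ`. -/
def masterPolynomial {n k : ℕ} (i j : ZMod (2 * k + 1) → Fin n) : EdgeRing n :=
  ∑ σ : Equiv.Perm (Letter k) with σ ∈ transpositionGroup k,
    ((Equiv.Perm.sign σ : ℤ) : EdgeRing n) * conjMonomial i j σ

/-- The master polynomials of degree `2k+1`. -/
def masterPolynomials (n k : ℕ) : Set (EdgeRing n) :=
  {f | ∃ i j : ZMod (2 * k + 1) → Fin n, Admissible i j ∧ f = masterPolynomial i j}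

/-- The `3 × 3` off-diagonal minors, the master polynomials of degree `3`, and the products of two
(possibly equal) `2 × 2` off-diagonal minors. -/
def symbolicSquareBasis (n : ℕ) : Set (EdgeRing n) :=
  offDiagonalMinors n 3 ∪ masterPolynomials n 1 ∪
    {f | ∃ g ∈ offDiagonalMinors n 2, ∃ h ∈ offDiagonalMinors n 2, f = g * h}

end Hypersimplex

end

noncomputable section

namespace Hypersimplex

open MvPolynomial

/-! ### Symbolic squares and derivatives -/

/-! Write `D` for `differentialSquare (toricIdeal n)`: the polynomials that lie in `I_n` together
with all their first partial derivatives. The basis `G` is compared with `D`, and the remaining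
ideals are squeezed between the two. Upper bounds: `I_n ^ 2`, the symbolic square and the secant
ideal all lie in `D`. The first two follow from the product rule and primality. For the secant
ideal, one moves a point of the toric variety by a rank-one point `(t_i t_j)` with nilpotent
coordinates that is supported on a single edge, and reads off the derivative along that edge. Lower
bounds: a variable times a `3 × 3` minor or a master polynomial is a combination of products of two
`2 × 2` minors, so `G` lies in the symbolic square. Both kinds of cubic also vanish at sums of two
points of the toric variety, so `G` lies in `I_n ^ 2 ⊔ secantIdeal I_n 2`. The point is that the
leading monomials of `G` already divide that of every nonzero `f ∈ D`. For a circular order, every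
leading monomial of `I_n` contains a noncrossing pair of edges of `K_n`: a multigraph without such a
pair is determined by its degree sequence (`eq_of_vertexDegree_eq`), so it is the smallest monomial
of its fibre under `φ_n`. In characteristic zero, if `u` is the leading monomial of `f` and a
variable `x` divides `u`, then `u / x` is the leading monomial of `∂f/∂x`. Hence `u` and all these
quotients contain noncrossing pairs, and `exists_two_edges_or_triangle` shows that `u` is divisible
by two such pairs or by three pairwise noncrossing edges. Two pairs come from a product of two `2 ×
2` minors. Three edges form one of the five noncrossing matchings of six points: the three with
parallel edges lead `3 × 3` minors, the other two lead master polynomials. So `G` is a Gröbner basis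
inside `D` for every circular order. As such an order exists, `G` generates `D`, and all the
inclusions are equalities. -/

theorem mem_symbolicPower_iff {R : Type*} [CommRing R] (I : Ideal R) [hI : I.IsPrime] (r : ℕ)
    (f : R) : f ∈ symbolicPower I r ↔ ∃ s, s ∉ I ∧ s * f ∈ I ^ r := by
  have key : ∀ (P : Ideal R) [P.IsPrime],
      f ∈ ((I ^ r).map (algebraMap R (Localization.AtPrime P))).comap
        (algebraMap R (Localization.AtPrime P)) ↔ ∃ s, s ∉ P ∧ s * f ∈ I ^ r := by
    intro P _
    rw [Ideal.mem_comap, IsLocalization.algebraMap_mem_map_algebraMap_iff P.primeCompl]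
    rfl
  unfold symbolicPower
  rw [Submodule.mem_iInf]
  constructor
  · intro h
    have hmem : I ∈ I.minimalPrimes := by
      rw [Ideal.minimalPrimes_eq_subsingleton_self]; exact Set.mem_singleton I
    exact (key I).1 (h ⟨I, hmem⟩)
  · rintro h ⟨P, hP⟩
    have hPI : P = I := by
      rw [Ideal.minimalPrimes_eq_subsingleton_self] at hP; exact hP
    subst hPI
    exact (key P).2 h

variable {σ K : Type*} [Field K]

/-- The polynomials of an ideal `I` whose first partial derivatives all lie in `I`. -/
def differentialSquare (I : Ideal (MvPolynomial σ K)) : Ideal (MvPolynomial σ K) where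
  carrier := {f | f ∈ I ∧ ∀ i, pderiv i f ∈ I}
  add_mem' := fun ha hb => ⟨I.add_mem ha.1 hb.1, fun i => by
    rw [map_add]; exact I.add_mem (ha.2 i) (hb.2 i)⟩
  zero_mem' := ⟨I.zero_mem, fun i => by rw [map_zero]; exact I.zero_mem⟩
  smul_mem' := fun c f hf => ⟨I.mul_mem_left c hf.1, fun i => by
    rw [smul_eq_mul, pderiv_mul]
    exact I.add_mem (I.mul_mem_left _ hf.1) (I.mul_mem_left _ (hf.2 i))⟩

theorem sq_le_differentialSquare (I : Ideal (MvPolynomial σ K)) :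
    I ^ 2 ≤ differentialSquare I := by
  rw [pow_two, Ideal.mul_le]
  refine fun f hf g hg => ⟨I.mul_mem_left _ hg, fun i => ?_⟩
  rw [pderiv_mul]
  exact I.add_mem (I.mul_mem_left _ hg) (I.mul_mem_right _ hf)

/-- If `s * f ∈ I ^ 2` with `s ∉ I`, primality gives `f ∈ I`; the product rule then leaves `s * ∂f ∈
I`, and primality applies again. -/
theorem symbolicPower_two_le_differentialSquare (I : Ideal (MvPolynomial σ K)) [hI : I.IsPrime] :
    symbolicPower I 2 ≤ differentialSquare I := by
  intro f hf
  obtain ⟨s, hs, hsf⟩ := (mem_symbolicPower_iff I 2 f).1 hf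
  have h := sq_le_differentialSquare I hsf
  have hfI : f ∈ I := (hI.mem_or_mem h.1).resolve_left hs
  refine ⟨hfI, fun i => ?_⟩
  have h2 := h.2 i
  rw [pderiv_mul] at h2
  have h3 := (I.add_mem_iff_right (I.mul_mem_left (pderiv i s) hfI)).1 h2
  exact (hI.mem_or_mem h3).resolve_left hs

/-! ### Gröbner bases -/

theorem monomial_mem_span_leadingTerm (m : MonomialOrder σ) {G : Set (MvPolynomial σ K)}
    {g : MvPolynomial σ K} (hg : g ∈ G) (h0 : g ≠ 0) {u : σ →₀ ℕ} (hu : m.degree g ≤ u) (c : K) :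
    monomial u c ∈ Ideal.span (m.leadingTerm '' G) := by
  have h : monomial u c =
      monomial (u - m.degree g) (c * (m.leadingCoeff g)⁻¹) * m.leadingTerm g := by
    rw [MonomialOrder.leadingTerm, monomial_mul, tsub_add_cancel_of_le hu, mul_assoc,
      inv_mul_cancel₀ (m.leadingCoeff_ne_zero_iff.2 h0), mul_one]
  rw [h]
  exact Ideal.mul_mem_left _ _ (Ideal.subset_span ⟨g, hg, rfl⟩)

theorem isGroebnerBasis_of_degree_le (m : MonomialOrder σ) {G : Set (MvPolynomial σ K)}
    {I : Ideal (MvPolynomial σ K)} (hfin : G.Finite) (hG : G ⊆ (I : Set (MvPolynomial σ K)))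
    (h : ∀ f ∈ I, f ≠ 0 → ∃ g ∈ G, g ≠ 0 ∧ m.degree g ≤ m.degree f) :
    IsGroebnerBasis m G I := by
  refine ⟨hfin, hG, le_antisymm (Ideal.span_mono (Set.image_mono hG)) (Ideal.span_le.2 ?_)⟩
  rintro _ ⟨f, hf, rfl⟩
  rcases eq_or_ne f 0 with rfl | h0
  · rw [MonomialOrder.leadingTerm_zero]; exact Ideal.zero_mem _
  · obtain ⟨g, hg, hg0, hle⟩ := h f hf h0
    exact monomial_mem_span_leadingTerm m hg hg0 hle _

/-- The remainder of an element of `I` on division by `G` is again in `I`; if it were nonzero, its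
leading monomial would be divisible by that of some element of `G`. -/
theorem span_eq_of_degree_le (m : MonomialOrder σ) {G : Set (MvPolynomial σ K)}
    {I : Ideal (MvPolynomial σ K)} (hG : G ⊆ (I : Set (MvPolynomial σ K)))
    (h : ∀ f ∈ I, f ≠ 0 → ∃ g ∈ G, g ≠ 0 ∧ m.degree g ≤ m.degree f) :
    Ideal.span G = I := by
  refine le_antisymm (Ideal.span_le.2 hG) fun f hf => ?_
  obtain ⟨q, r, hfr, -, hr⟩ := m.div_set (B := {g ∈ G | g ≠ 0})
    (fun b hb => (m.leadingCoeff_ne_zero_iff.2 hb.2).isUnit) f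
  have hq : Finsupp.linearCombination _ (fun b : {g ∈ G | g ≠ 0} => (b : MvPolynomial σ K)) q ∈
      Ideal.span G :=
    Submodule.sum_mem _ fun b _ => Ideal.mul_mem_left _ _ (Ideal.subset_span b.2.1)
  have hrI : r ∈ I := by
    have : r = f - Finsupp.linearCombination _
      (fun b : {g ∈ G | g ≠ 0} => (b : MvPolynomial σ K)) q := by rw [hfr]; ring
    rw [this]
    exact I.sub_mem hf (Ideal.span_le.2 hG hq)
  have hr0 : r = 0 := by
    by_contra h0
    obtain ⟨g, hg, hg0, hle⟩ := h r hrI h0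
    exact hr _ (m.degree_mem_support h0) g ⟨hg, hg0⟩ hle
  rw [hfr, hr0, add_zero]
  exact hq

/-- The factor `u i` produced by differentiation is nonzero in characteristic zero, and dividing
monomials by the same variable preserves their order. -/
theorem sub_single_mem_support_pderiv [CharZero K] {m : MonomialOrder σ} {f : MvPolynomial σ K}
    {u : σ →₀ ℕ} (hu : u ∈ f.support) (hmax : ∀ w ∈ f.support, m.toSyn w ≤ m.toSyn u) {i : σ}
    (hi : u i ≠ 0) :
    u - Finsupp.single i 1 ∈ (pderiv i f).support ∧
      ∀ w ∈ (pderiv i f).support, m.toSyn w ≤ m.toSyn (u - Finsupp.single i 1) := by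
  have hle : Finsupp.single i 1 ≤ u := by
    rw [Finsupp.single_le_iff]; omega
  have hadd : u - Finsupp.single i 1 + Finsupp.single i 1 = u := tsub_add_cancel_of_le hle
  constructor
  · rw [mem_support_iff, coeff_pderiv, hadd]
    exact mul_ne_zero (mem_support_iff.1 hu) (Nat.cast_add_one_ne_zero _)
  · intro w hw
    rw [mem_support_iff, coeff_pderiv] at hw
    have h := hmax _ (mem_support_iff.2 (left_ne_zero_of_mul hw))
    rw [← hadd, map_add, map_add] at h
    exact le_of_add_le_add_right h

/-- If `f` is a nonzero scalar multiple of a monomial `u` plus smaller terms, its degree is `u`. -/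
theorem degree_of_sub_monomial (m : MonomialOrder σ) {f h : MvPolynomial σ K} {u : σ →₀ ℕ} {c : K}
    (hc : c ≠ 0) (hf : f = monomial u c + h) (hh : ∀ w ∈ h.support, m.toSyn w < m.toSyn u) :
    f ≠ 0 ∧ m.degree f = u := by
  classical
  have hu : coeff u f = c := by
    have : coeff u h = 0 := by
      by_contra h0
      exact lt_irrefl _ (hh u (mem_support_iff.2 h0))
    rw [hf, coeff_add, coeff_monomial, if_pos rfl, this, add_zero]
  refine ⟨?_, m.toSyn.injective (le_antisymm ?_ ?_)⟩
  · rintro rfl; exact hc (by simpa using hu.symm)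
  · rw [MonomialOrder.degree_le_iff]
    intro w hw
    rcases eq_or_ne w u with rfl | hne
    · exact le_rfl
    · refine (hh w ?_).le
      rw [mem_support_iff, hf, coeff_add, coeff_monomial, if_neg hne.symm, zero_add] at hw
      exact mem_support_iff.2 hw
  · exact m.le_degree (mem_support_iff.2 (by rw [hu]; exact hc))

theorem lt_of_mem_support_add {m : MonomialOrder σ} {f g : MvPolynomial σ K} {u : σ →₀ ℕ}
    (hf : ∀ w ∈ f.support, m.toSyn w < m.toSyn u) (hg : ∀ w ∈ g.support, m.toSyn w < m.toSyn u) :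
    ∀ w ∈ (f + g).support, m.toSyn w < m.toSyn u := by
  classical
  intro w hw
  rcases Finset.mem_union.1 (support_add hw) with h | h
  exacts [hf w h, hg w h]

theorem lt_of_mem_support_monomial {m : MonomialOrder σ} {u v : σ →₀ ℕ} (c : K)
    (h : m.toSyn v < m.toSyn u) :
    ∀ w ∈ (monomial v c).support, m.toSyn w < m.toSyn u := by
  intro w hw
  rwa [Finset.mem_singleton.1 (support_monomial_subset hw)]

/-! ### Block orders -/

theorem IsBlockOrder.lt_of_forall {b : σ → ℕ} {m : MonomialOrder σ} (hm : IsBlockOrder b m)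
    {u v : σ →₀ ℕ} {s : σ} (hs : v s ≠ 0) (h : ∀ t, u t ≠ 0 → b s < b t) :
    m.toSyn u < m.toSyn v := by
  -- The comparison is decided in the first block that `v` meets; `u` has no variable in that block
  -- or in any earlier one.
  obtain ⟨s', hs', hmin⟩ := Finset.exists_min_image v.support b ⟨s, Finsupp.mem_support_iff.2 hs⟩
  have hss : b s' ≤ b s := hmin s (Finsupp.mem_support_iff.2 hs)
  refine hm (b s') u v (fun t ht => ?_) ?_
  · have h1 : u t = 0 := by
      by_contra h0; have := h t h0; omega
    have h2 : v t = 0 := by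
      by_contra h0; have := hmin t (Finsupp.mem_support_iff.2 h0); omega
    rw [h1, h2]
  · have h1 : u.filter (fun t => b t = b s') = 0 := by
      rw [Finsupp.filter_eq_zero_iff]
      intro t ht
      by_contra h0; have := h t h0; omega
    rw [h1, map_zero, MonomialOrder.toSyn_lt_iff_ne_zero, ne_eq, MonomialOrder.toSyn_eq_zero_iff,
      Finsupp.filter_eq_zero_iff]
    exact fun h0 => Finsupp.mem_support_iff.1 hs' (h0 s' rfl)

/-- A lexicographic order works once the variables are sorted by `b`, with ties broken by an
enumeration. It is needed because the equality of ideals mentions no term order. -/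
theorem exists_isBlockOrder.{u} {σ : Type u} [Finite σ] (b : σ → ℕ) :
    ∃ m : MonomialOrder.{u, u} σ, IsBlockOrder b m := by
  classical
  obtain ⟨N, ⟨e⟩⟩ := Finite.exists_equiv_fin σ
  let _ : LinearOrder σ := LinearOrder.lift' (fun s => toLex (b s, e s)) fun s t h =>
    e.injective (congrArg Prod.snd (toLex.injective h))
  have hb : ∀ s t : σ, s ≤ t → b s ≤ b t := by
    intro s t h
    have h' : toLex (b s, e s) ≤ toLex (b t, e t) := h
    rw [Prod.Lex.toLex_le_toLex] at h'
    rcases h' with h' | h'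
    exacts [h'.le, h'.1.le]
  refine ⟨MonomialOrder.lex, fun c u v huv h => ?_⟩
  rw [MonomialOrder.lex_lt_iff] at h ⊢
  obtain ⟨s, hs, hlt⟩ := h
  have hbs : b s = c := by
    by_contra hne
    simp [hne] at hlt
  refine ⟨s, fun t ht => ?_, ?_⟩
  · rcases (hb t s ht.le).lt_or_eq with h' | h'
    · exact huv t (by omega)
    · have := hs t ht
      simpa [h', hbs] using this
  · simpa [hbs] using hlt

/-! ### Second symbolic powers of edge ideals -/

open Finsupp in
/-- If a monomial stays in the edge ideal of a graph after division by any of its variables, then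
it is divisible by a product of two edges or by a triangle. -/
theorem exists_two_edges_or_triangle {σ : Type*} {r : σ → σ → Prop} (hirr : ∀ a, ¬ r a a)
    (hsymm : ∀ {a b}, r a b → r b a)
    {u : σ →₀ ℕ} (h0 : ∃ a b, r a b ∧ u a ≠ 0 ∧ u b ≠ 0)
    (h : ∀ i, u i ≠ 0 → ∃ a b, r a b ∧ (u - single i 1 : σ →₀ ℕ) a ≠ 0 ∧ (u - single i 1 : σ →₀ ℕ) b ≠ 0) :
    (∃ a b c d, r a b ∧ r c d ∧ (single a 1 + single b 1) + (single c 1 + single d 1) ≤ u) ∨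
    ∃ a b c, r a b ∧ r b c ∧ r a c ∧ single a 1 + single b 1 + single c 1 ≤ u := by
  classical
  have hne : ∀ {a b}, r a b → a ≠ b := fun hab e => hirr _ (e ▸ hab)
  have key : ∀ i, u i ≠ 0 → ∃ a b, r a b ∧ a ≠ b ∧ u a ≠ 0 ∧ u b ≠ 0 ∧ (a = i → 2 ≤ u a) ∧
      (b = i → 2 ≤ u b) := by
    intro i hi
    obtain ⟨a, b, hab, ha, hb⟩ := h i hi
    simp only [coe_tsub, Pi.sub_apply, single_apply] at ha hb
    refine ⟨a, b, hab, hne hab, by omega, by omega, fun e => ?_, fun e => ?_⟩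
    · rw [if_pos e.symm] at ha; omega
    · rw [if_pos e.symm] at hb; omega
  have two : ∀ a b c d, u a ≠ 0 → u b ≠ 0 → u c ≠ 0 → u d ≠ 0 → a ≠ b → c ≠ d →
      (a = c → 2 ≤ u a) → (a = d → 2 ≤ u a) → (b = c → 2 ≤ u b) → (b = d → 2 ≤ u b) →
      (single a 1 + single b 1) + (single c 1 + single d 1) ≤ u := by
    intro a b c d ha hb hc hd hab hcd h1 h2 h3 h4 s
    simp only [Finsupp.coe_add, Pi.add_apply, single_apply]
    split_ifs <;> grind
  have three : ∀ a b c, u a ≠ 0 → u b ≠ 0 → u c ≠ 0 → a ≠ b → b ≠ c → a ≠ c →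
      single a 1 + single b 1 + single c 1 ≤ u := by
    intro a b c ha hb hc hab hcd h1 s
    simp only [Finsupp.coe_add, Pi.add_apply, single_apply]
    split_ifs <;> grind
  -- Let `cd` be an edge surviving division by `a`, and `ef` one surviving division by `b`. If
  -- `ab·cd` does not divide `u`, then `b` lies on `cd` and has multiplicity one; if `ab·ef` does
  -- not, the same holds for `a` and `ef`. Then `cd` joins `b` to some `x ≠ a`, and `ef` joins `a`
  -- to some `y ≠ b`. Either `x = y` and there is a triangle, or the two edges are disjoint.
  obtain ⟨a, b, hab, ha, hb⟩ := h0
  obtain ⟨c, d, hcd, hcd', hc, hd, hc2, hd2⟩ := key a ha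
  obtain ⟨e, f, hef, hef', he, hf, he2, hf2⟩ := key b hb
  have hab' := hne hab
  by_contra hcon
  push Not at hcon
  obtain ⟨hcon1, hcon2⟩ := hcon
  have n1 := fun h1 h2 h3 h4 => hcon1 a b c d hab hcd
    (two a b c d ha hb hc hd hab' hcd' h1 h2 h3 h4)
  have n2 := fun h1 h2 h3 h4 => hcon1 a b e f hab hef
    (two a b e f ha hb he hf hab' hef' h1 h2 h3 h4)
  have n3 := fun h1 h2 h3 h4 => hcon1 c d e f hcd hef
    (two c d e f hc hd he hf hcd' hef' h1 h2 h3 h4)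
  have n4 : ∀ x, u x ≠ 0 → a ≠ x → b ≠ x → r b x → ¬ r a x :=
    fun x hx h1 h2 h3 h4 => hcon2 a b x hab h3 h4
      (three a b x ha hb hx hab' h2 h1)
  have hsc := hsymm hcd
  have hse := hsymm hef
  have n4d := n4 d hd
  have n4c := n4 c hc
  clear h key two three hcon1 hcon2 n4 hirr hne hsymm
  by_cases hbc : b = c
  · subst hbc
    grind +splitImp
  · by_cases hbd : b = d
    · subst hbd
      grind +splitImp
    · grind +splitImp

/-! ### Degree sequences -/

/-- The exponent of `φ_n` of the monomial with exponent `u`: the degree sequence of the multigraph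
with edge multiplicities `u`. -/
def vertexDegree {n : ℕ} : (Edge n →₀ ℕ) →+ (Fin n →₀ ℕ) :=
  Finsupp.liftAddHom fun e =>
    Finsupp.singleAddHom e.1.1 + Finsupp.singleAddHom e.1.2

theorem vertexDegree_single {n : ℕ} (e : Edge n) (k : ℕ) :
    vertexDegree (Finsupp.single e k) = Finsupp.single e.1.1 k + Finsupp.single e.1.2 k := by
  simp [vertexDegree]

theorem phi_monomial {n : ℕ} (u : Edge n →₀ ℕ) (c : ℂ) :
    phi n (monomial u c) = monomial (vertexDegree u) c := by
  induction u using Finsupp.induction_linear generalizing c with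
  | zero =>
    rw [map_zero]
    exact (phi n).commutes c
  | add u v hu hv =>
    have h : ∀ {τ : Type} (a b : τ →₀ ℕ),
        (monomial (a + b) c : MvPolynomial τ ℂ) = monomial a c * monomial b 1 := by
      intro τ a b; rw [monomial_mul, mul_one]
    rw [h, map_mul, hu, hv, map_add, h]
  | single e k =>
    rw [vertexDegree_single, ← C_mul_X_pow_eq_monomial, map_mul, map_pow,
      phi, aeval_X, mul_pow, X_pow_eq_monomial, X_pow_eq_monomial, monomial_mul, mul_one,
      ← algebraMap_eq, AlgHom.commutes, algebraMap_eq, C_mul_monomial, mul_one]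

theorem sum_mul_vertexDegree {n : ℕ} (χ : Fin n → ℤ) (u : Edge n →₀ ℕ) :
    ∑ k, χ k * vertexDegree u k = ∑ e, (u e : ℤ) * (χ e.1.1 + χ e.1.2) := by
  induction u using Finsupp.induction_linear with
  | zero => simp
  | add u v hu hv =>
    simp only [map_add, Finsupp.add_apply, Nat.cast_add, mul_add, add_mul, Finset.sum_add_distrib]
      at hu hv ⊢
    rw [hu, hv]; ring
  | single e k =>
    simp [vertexDegree_single, Finsupp.single_apply, mul_add, add_mul, Finset.sum_add_distrib, mul_comm]

/-! ### Noncrossing pairs of edges -/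

/-- The edges `e` and `f` have no common vertex and do not cross. -/
def Noncrossing {n : ℕ} (e f : Edge n) : Prop :=
  e.1.2 < f.1.1 ∨ f.1.2 < e.1.1 ∨ (e.1.1 < f.1.1 ∧ f.1.2 < e.1.2) ∨
    (f.1.1 < e.1.1 ∧ e.1.2 < f.1.2)

theorem Noncrossing.symm {n : ℕ} {e f : Edge n} (h : Noncrossing e f) : Noncrossing f e := by
  unfold Noncrossing at *; tauto

theorem not_noncrossing_self {n : ℕ} (e : Edge n) : ¬ Noncrossing e e := by
  have := e.2
  unfold Noncrossing; grind

/-- The number of edges with both ends in the interval `[a, b)`. -/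
def intervalCount {n : ℕ} (u : Edge n →₀ ℕ) (a b : ℕ) : ℤ :=
  ∑ e : Edge n, if a ≤ (e.1.1 : ℕ) ∧ (e.1.2 : ℕ) < b then (u e : ℤ) else 0

/-- Inclusion–exclusion: `e` is the only edge that lies in the closed interval spanned by its ends
but in neither interval with one end removed. -/
theorem apply_eq_intervalCount {n : ℕ} (u : Edge n →₀ ℕ) (e : Edge n) :
    (u e : ℤ) = intervalCount u e.1.1 (e.1.2 + 1) - intervalCount u (e.1.1 + 1) (e.1.2 + 1)
      - intervalCount u e.1.1 e.1.2 + intervalCount u (e.1.1 + 1) e.1.2 := by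
  unfold intervalCount
  rw [← Finset.sum_sub_distrib, ← Finset.sum_sub_distrib, ← Finset.sum_add_distrib]
  have h : (u e : ℤ) = ∑ f : Edge n, if e = f then (u f : ℤ) else 0 := by simp
  rw [h]
  refine Finset.sum_congr rfl fun f _ => ?_
  have : e = f ↔ (e.1.1 : ℕ) = f.1.1 ∧ (e.1.2 : ℕ) = f.1.2 := by
    rw [Subtype.ext_iff, Prod.ext_iff, Fin.ext_iff, Fin.ext_iff]
  simp only [this]
  split_ifs <;> omega

/-- A multigraph without noncrossing pairs of edges is determined by its degree sequence. -/
theorem eq_of_vertexDegree_eq {n : ℕ} {u v : Edge n →₀ ℕ}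
    (hu : ∀ e f, Noncrossing e f → u e = 0 ∨ u f = 0)
    (hv : ∀ e f, Noncrossing e f → v e = 0 ∨ v f = 0) (h : vertexDegree u = vertexDegree v) :
    u = v := by
  have key : ∀ a b, intervalCount u a b = intervalCount v a b := by
    intro a b
    -- With signs `±1`, an edge inside `[a, b)` contributes `2`, an edge outside contributes `-2`,
    -- and an edge with one end in the interval contributes `0`. So the degree sequence fixes the
    -- difference of the inside and outside counts.
    let χ : Fin n → ℤ := fun k => if a ≤ (k : ℕ) ∧ (k : ℕ) < b then 1 else -1
    let out : (Edge n →₀ ℕ) → ℤ := fun w => ∑ e : Edge n,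
      if ((e.1.1 : ℕ) < a ∨ b ≤ (e.1.1 : ℕ)) ∧ ((e.1.2 : ℕ) < a ∨ b ≤ (e.1.2 : ℕ)) then
        (w e : ℤ) else 0
    have hsub : ∀ w : Edge n →₀ ℕ,
        ∑ k, χ k * vertexDegree w k = 2 * intervalCount w a b - 2 * out w := by
      intro w
      rw [sum_mul_vertexDegree, intervalCount, Finset.mul_sum, Finset.mul_sum,
        ← Finset.sum_sub_distrib]
      refine Finset.sum_congr rfl fun e _ => ?_
      have := e.2
      rw [Fin.lt_def] at this
      simp only [χ]
      split_ifs <;> omega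
    have hnn : ∀ w : Edge n →₀ ℕ, 0 ≤ intervalCount w a b ∧ 0 ≤ out w := fun w =>
      ⟨Finset.sum_nonneg fun e _ => by split_ifs <;> positivity,
        Finset.sum_nonneg fun e _ => by split_ifs <;> positivity⟩
    -- An edge inside the interval and an edge outside it are noncrossing, so one of the counts is
    -- zero. Two nonnegative integers, one of them zero, are determined by their difference.
    have hprod : ∀ w : Edge n →₀ ℕ, (∀ e f, Noncrossing e f → w e = 0 ∨ w f = 0) →
        intervalCount w a b = 0 ∨ out w = 0 := by
      intro w hw
      by_contra! hcon
      obtain ⟨e, -, he⟩ := Finset.exists_ne_zero_of_sum_ne_zero hcon.1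
      obtain ⟨f, -, hf⟩ := Finset.exists_ne_zero_of_sum_ne_zero hcon.2
      rw [ne_eq, ite_eq_right_iff, Classical.not_imp] at he hf
      have h1 := e.2
      have h2 := f.2
      rcases hw e f (by unfold Noncrossing; simp only [Fin.lt_def] at *; omega) with h | h
      · exact he.2 (by rw [h]; rfl)
      · exact hf.2 (by rw [h]; rfl)
    have e1 := hsub u
    have e2 := hsub v
    rw [h] at e1
    have := hnn u
    have := hnn v
    have := hprod u hu
    have := hprod v hv
    omega
  ext e
  have h1 := apply_eq_intervalCount u e
  have h2 := apply_eq_intervalCount v e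
  simp only [key] at h1
  omega

/-! ### Circular orders -/

/-- The exponent of the variable `x_{ij} = x_{ji}`. -/
def edgeExp {n : ℕ} (i j : Fin n) : Edge n →₀ ℕ :=
  if h : i < j then Finsupp.single ⟨(i, j), h⟩ 1
  else if h : j < i then Finsupp.single ⟨(j, i), h⟩ 1 else 0

theorem edgeExp_comm {n : ℕ} (i j : Fin n) : edgeExp i j = edgeExp j i := by
  unfold edgeExp
  rcases lt_trichotomy i j with h | h | h
  · simp [h, h.not_gt]
  · simp [h]
  · simp [h, h.not_gt]

theorem edgeExp_of_lt {n : ℕ} {i j : Fin n} (h : i < j) :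
    edgeExp i j = Finsupp.single ⟨(i, j), h⟩ 1 := dif_pos h

theorem edgeVar_comm {n : ℕ} (i j : Fin n) : edgeVar i j = edgeVar j i := by
  unfold edgeVar
  rcases lt_trichotomy i j with h | h | h
  · simp [h, h.not_gt]
  · simp [h]
  · simp [h, h.not_gt]

theorem edgeVar_of_lt {n : ℕ} {i j : Fin n} (h : i < j) : edgeVar i j = X ⟨(i, j), h⟩ := dif_pos h

theorem edgeVar_eq_monomial {n : ℕ} {i j : Fin n} (h : i ≠ j) :
    edgeVar i j = monomial (edgeExp i j) 1 := by
  rcases lt_or_gt_of_ne h with h | h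
  · rw [edgeVar_of_lt h, edgeExp_of_lt h]; rfl
  · rw [edgeVar_comm, edgeExp_comm, edgeVar_of_lt h, edgeExp_of_lt h]; rfl

/-- In a circular order the crossing pair of edges on four vertices is the smallest of the three
pairs of disjoint edges. -/
theorem IsCircular.cross_lt {n : ℕ} {m : MonomialOrder (Edge n)} (hm : IsCircular m)
    {p q r s : Fin n} (h1 : p < q) (h2 : q < r) (h3 : r < s) :
    m.toSyn (edgeExp p r + edgeExp q s) < m.toSyn (edgeExp p q + edgeExp r s) ∧
    m.toSyn (edgeExp p r + edgeExp q s) < m.toSyn (edgeExp p s + edgeExp q r) := by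
  have main : ∀ {a b c d : Edge n},
      (edgeClass c < edgeClass a ∧ edgeClass c < edgeClass b) ∨
        (edgeClass d < edgeClass a ∧ edgeClass d < edgeClass b) →
      m.toSyn (Finsupp.single a 1 + Finsupp.single b 1) <
        m.toSyn (Finsupp.single c 1 + Finsupp.single d 1) := by
    intro a b c d h
    have key : ∀ c : Edge n, edgeClass c < edgeClass a ∧ edgeClass c < edgeClass b →
        ∀ t, (Finsupp.single a 1 + Finsupp.single b 1 : Edge n →₀ ℕ) t ≠ 0 →
          edgeClass c < edgeClass t := by
      intro c hc t ht
      rw [Finsupp.add_apply, Finsupp.single_apply, Finsupp.single_apply] at ht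
      by_cases h1 : a = t
      · exact h1 ▸ hc.1
      · by_cases h2 : b = t
        · exact h2 ▸ hc.2
        · simp [h1, h2] at ht
    rcases h with h | h
    · exact IsBlockOrder.lt_of_forall hm (s := c) (by simp) (key c h)
    · exact IsBlockOrder.lt_of_forall hm (s := d) (by simp) (key d h)
  rw [edgeExp_of_lt h1, edgeExp_of_lt h3, edgeExp_of_lt (h1.trans h2), edgeExp_of_lt (h2.trans h3),
    edgeExp_of_lt h2, edgeExp_of_lt (h1.trans (h2.trans h3))]
  have := s.2
  rw [Fin.lt_def] at h1 h2 h3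
  -- Of two opposite sides of the quadrilateral, the one spanning the shorter arc has smaller class
  -- than both diagonals: each diagonal cuts the circle into two arcs, both longer than that one.
  constructor <;> apply main <;> simp only [edgeClass] <;> omega

theorem vertexDegree_edgeExp {n : ℕ} {i j : Fin n} (h : i ≠ j) :
    vertexDegree (edgeExp i j) = Finsupp.single i 1 + Finsupp.single j 1 := by
  rcases lt_or_gt_of_ne h with h | h
  · rw [edgeExp_of_lt h, vertexDegree_single]
  · rw [edgeExp_comm, edgeExp_of_lt h, vertexDegree_single, add_comm]

theorem edgeExp_edge {n : ℕ} (e : Edge n) : edgeExp e.1.1 e.1.2 = Finsupp.single e 1 :=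
  edgeExp_of_lt e.2

/-- A noncrossing pair of edges can be replaced by the smaller crossing pair on the same vertices. -/
theorem Noncrossing.exists_lt {n : ℕ} {m : MonomialOrder (Edge n)} (hm : IsCircular m)
    {e f : Edge n} (h : Noncrossing e f) :
    ∃ w, vertexDegree w = vertexDegree (Finsupp.single e 1 + Finsupp.single f 1) ∧
      m.toSyn w < m.toSyn (Finsupp.single e 1 + Finsupp.single f 1) := by
  wlog hef : e.1.1 < f.1.1 generalizing e f
  · rw [add_comm]
    refine this h.symm ?_
    have h1 := e.2
    have h2 := f.2
    unfold Noncrossing at h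
    rcases h with h | h | h | h <;> order
  have h2 := f.2
  have h1 := e.2
  rw [← edgeExp_edge, ← edgeExp_edge]
  unfold Noncrossing at h
  have h' : e.1.2 < f.1.1 ∨ f.1.2 < e.1.2 := by
    rcases h with h | h | h | h
    · exact .inl h
    · order
    · exact .inr h.2
    · order
  rcases h' with h | h
  · refine ⟨_, ?_, (hm.cross_lt h1 h h2).1⟩
    simp only [map_add]
    rw [vertexDegree_edgeExp (h1.trans h).ne, vertexDegree_edgeExp (h.trans h2).ne,
      vertexDegree_edgeExp h1.ne, vertexDegree_edgeExp h2.ne]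
    abel
  · refine ⟨_, ?_, (hm.cross_lt hef h2 h).2⟩
    simp only [map_add]
    rw [vertexDegree_edgeExp (hef.trans h2).ne, vertexDegree_edgeExp (h2.trans h).ne,
      vertexDegree_edgeExp h1.ne, vertexDegree_edgeExp h2.ne]
    abel

/-- The largest monomial of a polynomial in `I_n` contains a noncrossing pair of edges. -/
theorem exists_noncrossing_of_mem_toricIdeal {n : ℕ} {m : MonomialOrder (Edge n)}
    (hm : IsCircular m) {f : EdgeRing n} (hf : f ∈ toricIdeal n) {u : Edge n →₀ ℕ}
    (hu : u ∈ f.support) (hmax : ∀ w ∈ f.support, m.toSyn w ≤ m.toSyn u) :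
    ∃ a b, Noncrossing a b ∧ u a ≠ 0 ∧ u b ≠ 0 := by
  classical
  by_contra! hcon
  have hu' : ∀ e f, Noncrossing e f → u e = 0 ∨ u f = 0 := fun e f hef =>
    or_iff_not_imp_left.2 (hcon e f hef)
  -- The smallest monomial `v` in the fibre of `u` has no noncrossing pair, since recrossing such a
  -- pair would give a smaller monomial. By uniqueness `u = v`.
  obtain ⟨v, hv, hvmin⟩ := WellFounded.has_min (InvImage.wf m.toSyn (wellFounded_lt (α := m.syn)))
    {v | vertexDegree v = vertexDegree u} ⟨u, rfl⟩
  have hv' : ∀ e f, Noncrossing e f → v e = 0 ∨ v f = 0 := by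
    intro e f hef
    by_contra! h0
    obtain ⟨w, hw, hlt⟩ := hef.exists_lt hm
    have hle : Finsupp.single e 1 + Finsupp.single f 1 ≤ v := by
      have hne : e ≠ f := fun h => not_noncrossing_self f (h ▸ hef)
      intro s
      rw [Finsupp.add_apply, Finsupp.single_apply, Finsupp.single_apply]
      split_ifs with h1 h2
      · exact absurd (h1.trans h2.symm) hne
      · subst h1; omega
      · rename_i h2; subst h2; omega
      · omega
    have hadd := tsub_add_cancel_of_le hle
    refine hvmin (v - (Finsupp.single e 1 + Finsupp.single f 1) + w) ?_ ?_
    · show vertexDegree _ = _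
      rw [map_add, hw, ← map_add, hadd]; exact hv
    · show m.toSyn _ < m.toSyn _
      conv_rhs => rw [← hadd]
      rw [map_add, map_add]
      gcongr
  obtain rfl : v = u := eq_of_vertexDegree_eq hv' hu' hv
  -- As `v` is both the largest monomial of `f` and the smallest of its fibre, no other term of `f`
  -- maps to the same monomial, so nothing cancels its coefficient.
  have h0 : coeff (vertexDegree v) (phi n f) = 0 := by
    rw [RingHom.mem_ker.1 hf, coeff_zero]
  rw [f.as_sum, map_sum, coeff_sum] at h0
  simp only [phi_monomial, coeff_monomial] at h0
  rw [Finset.sum_eq_single v, if_pos rfl] at h0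
  · exact mem_support_iff.1 hu h0
  · intro w hw hne
    rw [if_neg]
    intro h
    exact hvmin w h (lt_of_le_of_ne (hmax w hw) fun e => hne (m.toSyn.injective e))
  · exact fun h => absurd hu h

/-! ### The secant ideal consists of polynomials with derivatives in the ideal -/

/-- The first-order Taylor expansion in one variable; the higher terms vanish with `ε²`. -/
theorem aeval_add_single {σ K S : Type*} [Field K] [DecidableEq σ] [CommRing S] [Algebra K S]
    (φ : MvPolynomial σ K →ₐ[K] S) {ε : S} (hε : ε * ε = 0) (e : σ) (f : MvPolynomial σ K) :
    aeval (fun s => φ (X s) + if s = e then ε else 0) f = φ f + ε * φ (pderiv e f) := by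
  induction f using MvPolynomial.induction_on with
  | C a => simp [← algebraMap_eq]
  | add p q hp hq => simp only [map_add, hp, hq]; ring
  | mul_X p s hp =>
    rw [map_mul, hp, aeval_X, pderiv_mul, map_add, map_mul, map_mul, map_mul, pderiv_X]
    by_cases h : s = e
    · subst h
      simp only [if_true, Pi.single_eq_same, map_one]
      linear_combination φ (pderiv s p) * hε
    · simp only [if_neg h, Pi.single_eq_of_ne h, map_zero]
      ring

instance toricIdeal_isPrime (n : ℕ) : (toricIdeal n).IsPrime := RingHom.ker_isPrime _

/-- A polynomial in the secant ideal vanishes at the sum of a point of the toric variety and a point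
in the image of its parametrization. -/
theorem aeval_add_eq_zero_of_mem_secantIdeal {n : ℕ} {S : Type*} [CommRing S] [Algebra ℂ S]
    (φ : EdgeRing n →ₐ[ℂ] S) (hφ : ∀ p ∈ toricIdeal n, φ p = 0) (t : Fin n → S) {f : EdgeRing n}
    (hf : f ∈ secantIdeal (toricIdeal n) 2) :
    aeval (fun e : Edge n => φ (X e) + t e.1.1 * t e.1.2) f = 0 := by
  let θ : MvPolynomial (Fin 2 × Edge n) ℂ →ₐ[ℂ] S :=
    aeval fun s => if s.1 = 0 then φ (X s.2) else t s.2.1.1 * t s.2.1.2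
  have h0 : θ.comp (rename fun s => ((0 : Fin 2), s)) = φ := by
    ext e : 1
    simp [θ]
  have h1 : θ.comp (rename fun s => ((1 : Fin 2), s)) = (aeval t).comp (phi n) := by
    ext e : 1
    simp [θ, phi]
  have hJ : (⨆ k : Fin 2, (toricIdeal n).map (rename (R := ℂ) fun s : Edge n => (k, s))) ≤
      RingHom.ker θ := by
    refine iSup_le fun k => Ideal.map_le_iff_le_comap.2 fun p hp => ?_
    rw [Ideal.mem_comap, RingHom.mem_ker]
    fin_cases k
    · exact (DFunLike.congr_fun h0 p).trans (hφ p hp)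
    · refine (DFunLike.congr_fun h1 p).trans ?_
      rw [AlgHom.comp_apply, RingHom.mem_ker.1 hp, map_zero]
  have hcomp : θ.comp (aeval fun s : Edge n => ∑ k : Fin 2, X (k, s)) =
      aeval fun e : Edge n => φ (X e) + t e.1.1 * t e.1.2 := by
    ext e : 1
    simp [θ, Fin.sum_univ_two]
  exact (DFunLike.congr_fun hcomp f).symm.trans (RingHom.mem_ker.1 (hJ hf))

theorem add_mul_pderiv_eq_zero_of_mem_secantIdeal {n : ℕ} {S : Type*} [CommRing S] [Algebra ℂ S]
    (φ : EdgeRing n →ₐ[ℂ] S) (hφ : ∀ p ∈ toricIdeal n, φ p = 0) {α β : S} (hα : α * α = 0)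
    (hβ : β * β = 0) {f : EdgeRing n} (hf : f ∈ secantIdeal (toricIdeal n) 2) (e₀ : Edge n) :
    φ f + α * β * φ (pderiv e₀ f) = 0 := by
  have hαβ : (α * β) * (α * β) = 0 := by linear_combination β * β * hα
  rw [← aeval_add_single φ hαβ e₀ f]
  -- With `t` equal to `α` and `β` at the ends of `e₀` and zero elsewhere, the point `(t_i t_j)` has
  -- the single nonzero coordinate `αβ`, at `e₀`.
  have h := aeval_add_eq_zero_of_mem_secantIdeal φ hφ
    (fun v => if v = e₀.1.1 then α else if v = e₀.1.2 then β else 0) hf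
  refine Eq.trans (congrArg (fun g : Edge n → S => aeval g f) (funext fun e => ?_)) h
  rw [add_right_inj]
  have h1 := e.2
  have h2 := e₀.2
  by_cases h : e = e₀
  · subst h
    simp [h1.ne']
  · rw [if_neg h]
    rw [Subtype.ext_iff, Prod.ext_iff] at h
    split_ifs <;> first | simp [hα, hβ] | (exfalso; grind)

/-- Iterated dual numbers supply two independent elements of square zero whose product is nonzero;
comparing coefficients of that product isolates the derivative. -/
theorem eq_zero_of_mem_secantIdeal {n : ℕ} {A : Type*} [CommRing A] [Algebra ℂ A]
    (q : EdgeRing n →ₐ[ℂ] A) (hq : ∀ p ∈ toricIdeal n, q p = 0) {f : EdgeRing n}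
    (hf : f ∈ secantIdeal (toricIdeal n) 2) (e₀ : Edge n) : q (pderiv e₀ f) = 0 := by
  let φ : EdgeRing n →ₐ[ℂ] DualNumber (DualNumber A) :=
    (TrivSqZeroExt.inlAlgHom ℂ (DualNumber A) (DualNumber A)).comp
      ((TrivSqZeroExt.inlAlgHom ℂ A A).comp q)
  have hφ : ∀ p, φ p = TrivSqZeroExt.inl (TrivSqZeroExt.inl (q p)) := fun p => rfl
  let α : DualNumber (DualNumber A) := TrivSqZeroExt.inl (DualNumber.eps : DualNumber A)
  have hα : α * α = 0 := by
    refine (TrivSqZeroExt.inl_mul _ (DualNumber.eps : DualNumber A) DualNumber.eps).symm.trans ?_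
    rw [DualNumber.eps_mul_eps, TrivSqZeroExt.inl_zero]
  have hφ0 : ∀ p ∈ toricIdeal n, φ p = 0 := fun p hp => by rw [hφ, hq p hp]; rfl
  have h := add_mul_pderiv_eq_zero_of_mem_secantIdeal φ hφ0 hα
    (β := (DualNumber.eps : DualNumber (DualNumber A))) DualNumber.eps_mul_eps hf e₀
  rw [hφ, hφ] at h
  simpa [α] using congrArg (fun s : DualNumber (DualNumber A) => s.snd.snd) h

theorem secantIdeal_le_differentialSquare (n : ℕ) :
    secantIdeal (toricIdeal n) 2 ≤ differentialSquare (toricIdeal n) := by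
  intro f hf
  have hq : ∀ p ∈ toricIdeal n, Ideal.Quotient.mkₐ ℂ (toricIdeal n) p = 0 :=
    fun p hp => Ideal.Quotient.eq_zero_iff_mem.2 hp
  refine ⟨?_, fun e => Ideal.Quotient.eq_zero_iff_mem.1 (eq_zero_of_mem_secantIdeal _ hq hf e)⟩
  -- Adding the zero point shows that `f` itself lies in `I_n`.
  have h := aeval_add_eq_zero_of_mem_secantIdeal _ hq (fun _ => 0) hf
  simp only [mul_zero, add_zero] at h
  rw [← Ideal.Quotient.eq_zero_iff_mem]
  refine Eq.trans ?_ h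
  exact DFunLike.congr_fun (aeval_unique (Ideal.Quotient.mkₐ ℂ (toricIdeal n))) f

/-! ### Minors and master polynomials -/

theorem phi_edgeVar {n : ℕ} {i j : Fin n} (h : i ≠ j) : phi n (edgeVar i j) = X i * X j := by
  rcases lt_or_gt_of_ne h with h | h
  · rw [edgeVar_of_lt h, phi, aeval_X]
  · rw [edgeVar_comm, edgeVar_of_lt h, phi, aeval_X, mul_comm]

theorem edgeVar_notMem_toricIdeal {n : ℕ} {i j : Fin n} (h : i ≠ j) :
    edgeVar i j ∉ toricIdeal n := by
  rw [toricIdeal, RingHom.mem_ker, phi_edgeVar h]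
  exact mul_ne_zero (X_ne_zero _) (X_ne_zero _)

theorem minor_mem_toricIdeal {n : ℕ} {a b c d : Fin n} (h1 : a ≠ b) (h2 : a ≠ d) (h3 : c ≠ b)
    (h4 : c ≠ d) : edgeVar a b * edgeVar c d - edgeVar a d * edgeVar c b ∈ toricIdeal n := by
  rw [toricIdeal, RingHom.mem_ker, map_sub, map_mul, map_mul, phi_edgeVar h1, phi_edgeVar h2,
    phi_edgeVar h3, phi_edgeVar h4]
  ring

theorem mem_toricIdeal_of_mem_offDiagonalMinors {n : ℕ} {f : EdgeRing n}
    (hf : f ∈ offDiagonalMinors n 2) : f ∈ toricIdeal n := by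
  obtain ⟨r, c, h, rfl⟩ := hf
  rw [Matrix.det_fin_two]
  exact minor_mem_toricIdeal (h _ _) (h _ _) (h _ _) (h _ _)

/-- The determinant with rows `a₁`, `a₂`, `a₃` and columns `b₁`, `b₂`, `b₃`, the rows being taken
from three families `p`, `q`, `r`. -/
def detForm {V R : Type*} [CommRing R] (p q r : V → V → R) (a₁ a₂ a₃ b₁ b₂ b₃ : V) : R :=
  p a₁ b₁ * q a₂ b₂ * r a₃ b₃ - p a₁ b₁ * q a₂ b₃ * r a₃ b₂ - p a₁ b₂ * q a₂ b₁ * r a₃ b₃ +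
    p a₁ b₂ * q a₂ b₃ * r a₃ b₁ + p a₁ b₃ * q a₂ b₁ * r a₃ b₂ - p a₁ b₃ * q a₂ b₂ * r a₃ b₁

/-- The trilinear form underlying the master polynomials of degree `3`. -/
def masterForm {V R : Type*} [CommRing R] (p q r : V → V → R) (a a' b b' c c' : V) : R :=
  p a b' * q b c' * r c a' - p a' b' * q b c' * r c a - p a b * q b' c' * r c a' -
    p a b' * q b c * r c' a' + p a' b * q b' c' * r c a + p a' b' * q b c * r c' a +
    p a b * q b' c * r c' a' - p a' b * q b' c * r c' a

/-- A sum of two matrices of rank one has vanishing `3 × 3` minors. Expand row by row: in each of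
the eight terms two rows come from the same matrix, and Laplace expansion along the other row leaves
its `2 × 2` minors. -/
theorem detForm_add_eq_zero {V R : Type*} [CommRing R] {y z : V → V → R}
    {a₁ a₂ a₃ b₁ b₂ b₃ : V} {s : Set V} {t : Set V} (hs : a₁ ∈ s ∧ a₂ ∈ s ∧ a₃ ∈ s)
    (ht : b₁ ∈ t ∧ b₂ ∈ t ∧ b₃ ∈ t)
    (hy : ∀ a ∈ s, ∀ b ∈ t, ∀ c ∈ s, ∀ d ∈ t, y a b * y c d - y a d * y c b = 0)
    (hz : ∀ a ∈ s, ∀ b ∈ t, ∀ c ∈ s, ∀ d ∈ t, z a b * z c d - z a d * z c b = 0) :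
    detForm (y + z) (y + z) (y + z) a₁ a₂ a₃ b₁ b₂ b₃ = 0 := by
  obtain ⟨ha1, ha2, ha3⟩ := hs
  obtain ⟨hb1, hb2, hb3⟩ := ht
  have key : ∀ y : V → V → R,
      (∀ a ∈ s, ∀ b ∈ t, ∀ c ∈ s, ∀ d ∈ t, y a b * y c d - y a d * y c b = 0) →
      ∀ w, detForm y y w a₁ a₂ a₃ b₁ b₂ b₃ = 0 ∧ detForm y w y a₁ a₂ a₃ b₁ b₂ b₃ = 0 ∧
        detForm w y y a₁ a₂ a₃ b₁ b₂ b₃ = 0 := by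
    intro y hy w
    unfold detForm
    refine ⟨?_, ?_, ?_⟩
    · linear_combination w a₃ b₃ * hy _ ha1 _ hb1 _ ha2 _ hb2 -
        w a₃ b₂ * hy _ ha1 _ hb1 _ ha2 _ hb3 + w a₃ b₁ * hy _ ha1 _ hb2 _ ha2 _ hb3
    · linear_combination -w a₂ b₃ * hy _ ha1 _ hb1 _ ha3 _ hb2 +
        w a₂ b₂ * hy _ ha1 _ hb1 _ ha3 _ hb3 - w a₂ b₁ * hy _ ha1 _ hb2 _ ha3 _ hb3
    · linear_combination w a₁ b₃ * hy _ ha2 _ hb1 _ ha3 _ hb2 -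
        w a₁ b₂ * hy _ ha2 _ hb1 _ ha3 _ hb3 + w a₁ b₁ * hy _ ha2 _ hb2 _ ha3 _ hb3
  obtain ⟨h1, h2, h3⟩ := key y hy z
  obtain ⟨h4, h5, h6⟩ := key z hz y
  have h7 := (key y hy y).1
  have h8 := (key z hz z).1
  unfold detForm at *
  simp only [Pi.add_apply]
  linear_combination h1 + h2 + h3 + h4 + h5 + h6 + h7 + h8

/-- The same polarization: in each of the eight terms two slots carry the same symmetric array, and
the term is a combination of its off-diagonal `2 × 2` minors. -/
theorem masterForm_add_eq_zero {V R : Type*} [CommRing R] {y z : V → V → R}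
    {a a' b b' c c' : V} (hys : ∀ i j, y i j = y j i) (hzs : ∀ i j, z i j = z j i)
    (hd : [a, a', b, b', c, c'].Nodup)
    (hy : ∀ a b c d, a ≠ b → a ≠ d → c ≠ b → c ≠ d → y a b * y c d - y a d * y c b = 0)
    (hz : ∀ a b c d, a ≠ b → a ≠ d → c ≠ b → c ≠ d → z a b * z c d - z a d * z c b = 0) :
    masterForm (y + z) (y + z) (y + z) a a' b b' c c' = 0 := by
  have key : ∀ y : V → V → R, (∀ i j, y i j = y j i) →
      (∀ a b c d, a ≠ b → a ≠ d → c ≠ b → c ≠ d → y a b * y c d - y a d * y c b = 0) →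
      ∀ (w : V → V → R) (a a' b b' c c' : V), [a, a', b, b', c, c'].Nodup →
        masterForm y y w a a' b b' c c' = 0 := by
    intro y hs hy w a a' b b' c c' hd
    simp only [List.nodup_cons, List.mem_cons, List.not_mem_nil, or_false, not_or,
      List.nodup_nil, and_true, not_false_eq_true] at hd
    have e : ∀ a c, a ≠ b → a ≠ b' → c ≠ b → c ≠ b' → y a b * y b' c - y a b' * y b c = 0 := by
      intro a c h1 h2 h3 h4
      rw [hs b' c, hs b c]
      exact hy a b c b' h1 h2 h3 h4
    unfold masterForm
    linear_combination -w c a' * e a c' (by tauto) (by tauto) (by grind) (by grind) +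
      w c' a' * e a c (by tauto) (by tauto) (by grind) (by grind) +
      w c a * e a' c' (by tauto) (by tauto) (by grind) (by grind) -
      w c' a * e a' c (by tauto) (by tauto) (by grind) (by grind)
  -- Rotating the three pairs of vertices permutes the slots cyclically, so it suffices to treat `w`
  -- in the last slot.
  have hd2 : [b, b', c, c', a, a'].Nodup := by
    have : [b, b', c, c', a, a'].Perm [a, a', b, b', c, c'] :=
      List.perm_append_comm (l₁ := [b, b', c, c']) (l₂ := [a, a'])
    exact this.nodup_iff.2 hd
  have hd3 : [c, c', a, a', b, b'].Nodup := by
    have : [c, c', a, a', b, b'].Perm [a, a', b, b', c, c'] :=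
      List.perm_append_comm (l₁ := [c, c']) (l₂ := [a, a', b, b'])
    exact this.nodup_iff.2 hd
  have h1 := key y hys hy z _ _ _ _ _ _ hd
  have h2 := key y hys hy z _ _ _ _ _ _ hd2
  have h3 := key y hys hy z _ _ _ _ _ _ hd3
  have h4 := key z hzs hz y _ _ _ _ _ _ hd
  have h5 := key z hzs hz y _ _ _ _ _ _ hd2
  have h6 := key z hzs hz y _ _ _ _ _ _ hd3
  have h7 := key y hys hy y _ _ _ _ _ _ hd
  have h8 := key z hzs hz z _ _ _ _ _ _ hd
  unfold masterForm at *
  simp only [Pi.add_apply]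
  linear_combination h1 + h2 + h3 + h4 + h5 + h6 + h7 + h8

theorem det_eq_detForm {n : ℕ} (r c : Fin 3 → Fin n) :
    (Matrix.of fun a b => edgeVar (r a) (c b)).det =
      detForm edgeVar edgeVar edgeVar (r 0) (r 1) (r 2) (c 0) (c 1) (c 2) := by
  rw [Matrix.det_fin_three]
  rfl

/-- The product of a subset of the three transpositions generating the group `Z` of a master
polynomial of degree `3`. -/
def swapProduct (b : Bool × Bool × Bool) : Equiv.Perm (Letter 1) :=
  (if b.1 then Equiv.swap (Sum.inl 0) (Sum.inr 2) else 1) *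
    ((if b.2.1 then Equiv.swap (Sum.inl 1) (Sum.inr 0) else 1) *
      (if b.2.2 then Equiv.swap (Sum.inl 2) (Sum.inr 1) else 1))

/-- The three transpositions are disjoint, so they commute and generate a group of order eight; only
stability under left multiplication by a generator has to be checked. -/
theorem mem_transpositionGroup_one_iff (σ : Equiv.Perm (Letter 1)) :
    σ ∈ transpositionGroup 1 ↔ ∃ b, swapProduct b = σ := by
  constructor
  · intro h
    have key : ∀ (l : ZMod (2 * 1 + 1)) (b : Bool × Bool × Bool), ∃ b',
        swapProduct b' = Equiv.swap (Sum.inl l : Letter 1) (Sum.inr (l - 1)) * swapProduct b := by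
      decide +kernel
    induction h using Subgroup.closure_induction_left with
    | one => exact ⟨(false, false, false), rfl⟩
    | mul_left x hx y hy ih =>
      obtain ⟨l, rfl⟩ := hx
      obtain ⟨b, rfl⟩ := ih
      exact key l b
    | inv_mul_cancel x hx y hy ih =>
      obtain ⟨l, rfl⟩ := hx
      obtain ⟨b, rfl⟩ := ih
      rw [Equiv.swap_inv]
      exact key l b
  · rintro ⟨b, rfl⟩
    have hmem : ∀ (l l' : ZMod (2 * 1 + 1)) (c : Bool), l - 1 = l' →
        (if c then Equiv.swap (Sum.inl l : Letter 1) (Sum.inr l') else 1) ∈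
          transpositionGroup 1 := by
      rintro l _ c rfl
      split_ifs
      · exact Subgroup.subset_closure ⟨l, rfl⟩
      · exact one_mem _
    exact mul_mem (hmem 0 2 _ (by decide)) (mul_mem (hmem 1 0 _ (by decide))
      (hmem 2 1 _ (by decide)))

theorem swapProduct_injective : Function.Injective swapProduct := by
  unfold Function.Injective
  decide +kernel

/-- For `k = 1` the shift `l + k - 1` is `l`, so `i_l` is matched with `j_l`. The arguments of the
form are grouped into the pairs `i_l`, `j_{l-1}` that `Z` swaps. -/
theorem masterPolynomial_eq_masterForm {n : ℕ} (i j : ZMod (2 * 1 + 1) → Fin n) :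
    masterPolynomial (k := 1) i j =
      masterForm edgeVar edgeVar edgeVar (i 0) (j 2) (i 1) (j 0) (i 2) (j 1) := by
  classical
  have hfilter : (Finset.univ.filter fun σ : Equiv.Perm (Letter 1) => σ ∈ transpositionGroup 1) =
      Finset.univ.image swapProduct := by
    ext σ
    simp [mem_transpositionGroup_one_iff]
  have hconj : ∀ σ, conjMonomial (k := 1) i j σ =
      edgeVar (Sum.elim i j (σ (Sum.inl 0))) (Sum.elim i j (σ (Sum.inr 0))) *
      edgeVar (Sum.elim i j (σ (Sum.inl 1))) (Sum.elim i j (σ (Sum.inr 1))) *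
      edgeVar (Sum.elim i j (σ (Sum.inl 2))) (Sum.elim i j (σ (Sum.inr 2))) := by
    intro σ
    have h : ∀ l : ZMod (2 * 1 + 1), l + ((1 : ℕ) : ZMod (2 * 1 + 1)) - 1 = l := by
      intro l; push_cast; ring
    unfold conjMonomial
    simp only [h]
    exact Fin.prod_univ_three (M := EdgeRing n) fun l : Fin 3 =>
      edgeVar (Sum.elim i j (σ (Sum.inl (l : ZMod (2 * 1 + 1)))))
        (Sum.elim i j (σ (Sum.inr (l : ZMod (2 * 1 + 1)))))
  have hsign : ∀ b, Equiv.Perm.sign (swapProduct b) =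
      (if b.1 then -1 else 1) * ((if b.2.1 then -1 else 1) * (if b.2.2 then -1 else 1)) := by
    rintro ⟨b0, b1, b2⟩
    cases b0 <;> cases b1 <;> cases b2 <;> simp [swapProduct]
  have hl : ∀ (b : Bool × Bool × Bool),
      swapProduct b (Sum.inl 0) = (if b.1 then Sum.inr 2 else Sum.inl 0) ∧
      swapProduct b (Sum.inl 1) = (if b.2.1 then Sum.inr 0 else Sum.inl 1) ∧
      swapProduct b (Sum.inl 2) = (if b.2.2 then Sum.inr 1 else Sum.inl 2) ∧
      swapProduct b (Sum.inr 0) = (if b.2.1 then Sum.inl 1 else Sum.inr 0) ∧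
      swapProduct b (Sum.inr 1) = (if b.2.2 then Sum.inl 2 else Sum.inr 1) ∧
      swapProduct b (Sum.inr 2) = (if b.1 then Sum.inl 0 else Sum.inr 2) := by
    decide +kernel
  unfold masterPolynomial
  rw [show (∑ σ : Equiv.Perm (Letter 1) with σ ∈ transpositionGroup 1, _) = _ from
    Finset.sum_congr hfilter fun _ _ => rfl, Finset.sum_image swapProduct_injective.injOn]
  simp only [hconj, hsign, hl, Fintype.sum_prod_type, Fintype.sum_bool]
  unfold masterForm
  simp
  ring

/-! ### The basis lies in the symbolic square -/

theorem Admissible.nodup {n : ℕ} {i j : ZMod (2 * 1 + 1) → Fin n} (h : Admissible (k := 1) i j) :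
    [i 0, j 2, i 1, j 0, i 2, j 1].Nodup := by
  obtain ⟨h1, h2, h3⟩ := h
  have e : ∀ l : ZMod (2 * 1 + 1), l + ((1 : ℕ) : ZMod (2 * 1 + 1)) - 1 = l := by
    intro l; push_cast; ring
  simp only [e] at h3
  have a1 := h1 0
  have a2 := h1 1
  have a3 := h1 2
  have b1 := h2 0 1 (by decide)
  have b2 := h2 1 2 (by decide)
  have c1 := h3 0
  have c2 := h3 1
  have c3 := h3 2
  have d : ∀ {x y : Fin n}, x - i 0 < y - i 0 → x ≠ y ∧ y ≠ x := fun h =>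
    ⟨fun e => h.ne (by rw [e]), fun e => h.ne (by rw [e])⟩
  have := d (a1.trans_lt b1)
  have := d ((a1.trans_lt b1).trans_le a2)
  have := d ((a1.trans_lt b1).trans_le (a2.trans b2.le))
  have := d ((a1.trans_lt b1).trans_le (a2.trans (b2.le.trans a3)))
  have := d b1
  have := d (b1.trans_le a2)
  have := d (b1.trans_le (a2.trans b2.le))
  have := d (b1.trans_le (a2.trans (b2.le.trans a3)))
  have := d (a2.trans_lt b2)
  have := d ((a2.trans_lt b2).trans_le a3)
  have := d b2
  have := d (b2.trans_le a3)
  simp only [List.nodup_cons, List.mem_cons, List.not_mem_nil, or_false, not_or,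
    List.nodup_nil, and_true, not_false_eq_true]
  grind

theorem symbolicSquareBasis_subset_symbolicPower (n : ℕ) :
    symbolicSquareBasis n ⊆ (symbolicPower (toricIdeal n) 2 : Set (EdgeRing n)) := by
  have hprod : ∀ {f g : EdgeRing n}, f ∈ toricIdeal n → g ∈ toricIdeal n →
      f * g ∈ toricIdeal n ^ 2 := fun hf hg => by rw [pow_two]; exact Ideal.mul_mem_mul hf hg
  rintro f ((⟨r, c, h, rfl⟩ | ⟨i, j, h, rfl⟩) | ⟨g, hg, k, hk, rfl⟩) <;>
    rw [SetLike.mem_coe, mem_symbolicPower_iff]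
  -- Chio's condensation: the pivot entry times the `3 × 3` determinant is the `2 × 2` determinant
  -- of the minors through the pivot.
  · refine ⟨edgeVar (r 0) (c 0), edgeVar_notMem_toricIdeal (h _ _), ?_⟩
    rw [det_eq_detForm]
    have M : ∀ k l, edgeVar (r 0) (c 0) * edgeVar (r k) (c l) -
        edgeVar (r 0) (c l) * edgeVar (r k) (c 0) ∈ toricIdeal n := fun k l =>
      minor_mem_toricIdeal (h _ _) (h _ _) (h _ _) (h _ _)
    have := Ideal.sub_mem _ (hprod (M 1 1) (M 2 2)) (hprod (M 1 2) (M 2 1))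
    convert this using 1
    unfold detForm
    ring
  · rw [masterPolynomial_eq_masterForm]
    have hd := h.nodup
    generalize i 0 = a, j 2 = a', i 1 = b, j 0 = b', i 2 = c, j 1 = c' at hd
    simp only [List.nodup_cons, List.mem_cons, List.not_mem_nil, or_false, not_or,
      List.nodup_nil, and_true, not_false_eq_true] at hd
    -- An analogue of condensation: `x_{ab}`, with `a` and `b` from different swapped pairs, times
    -- the master polynomial is a signed sum of three products of two minors.
    refine ⟨edgeVar a b, edgeVar_notMem_toricIdeal (by tauto), ?_⟩
    have M : ∀ {p q r s : Fin n}, p ≠ q → p ≠ s → r ≠ q → r ≠ s →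
      edgeVar p q * edgeVar r s - edgeVar p s * edgeVar r q ∈ toricIdeal n := minor_mem_toricIdeal
    have h1 := hprod (M (p := a) (q := b) (r := c') (s := b') (by grind) (by grind) (by grind)
      (by grind))
      (M (p := a) (q := b) (r := a') (s := c) (by grind) (by grind) (by grind)
      (by grind))
    have h2 := hprod (M (p := a) (q := b) (r := c) (s := b') (by grind) (by grind) (by grind)
      (by grind))
      (M (p := a) (q := b) (r := a') (s := c') (by grind) (by grind) (by grind)
      (by grind))
    have h3 := hprod (M (p := a) (q := b) (r := a') (s := b') (by grind) (by grind) (by grind)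
      (by grind))
      (M (p := b) (q := c') (r := a) (s := c) (by grind) (by grind) (by grind)
      (by grind))
    have := Ideal.sub_mem _ (Ideal.sub_mem _ h2 h1) h3
    convert this using 1
    have e := edgeVar_comm (n := n)
    rw [e c' b, e a' c, e c' b', e c b, e c b', e a' c', e a c', e a c]
    unfold masterForm
    ring
  · exact ⟨1, (Ideal.ne_top_iff_one _).1 (toricIdeal_isPrime n).ne_top,
      by
        rw [one_mul]
        exact hprod (mem_toricIdeal_of_mem_offDiagonalMinors hg)
          (mem_toricIdeal_of_mem_offDiagonalMinors hk)⟩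

theorem symbolicSquareBasis_subset_sup (n : ℕ) :
    symbolicSquareBasis n ⊆
      (toricIdeal n ^ 2 ⊔ secantIdeal (toricIdeal n) 2 : Ideal (EdgeRing n)) := by
  let J : Ideal (MvPolynomial (Fin 2 × Edge n) ℂ) :=
    ⨆ k : Fin 2, (toricIdeal n).map (rename (R := ℂ) fun s : Edge n => (k, s))
  -- Modulo `J`, the maps `ψ 0` and `ψ 1` are two generic points of the toric variety and `χ` is
  -- evaluation at their sum.
  let ψ : Fin 2 → EdgeRing n →ₐ[ℂ] _ := fun k => (Ideal.Quotient.mkₐ ℂ J).comp (rename fun s => (k, s))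
  let χ : EdgeRing n →ₐ[ℂ] _ := (Ideal.Quotient.mkₐ ℂ J).comp
    (aeval fun s : Edge n => ∑ k : Fin 2, (X (k, s) : MvPolynomial (Fin 2 × Edge n) ℂ))
  let y : Fin 2 → Fin n → Fin n → _ := fun k a b => ψ k (edgeVar a b)
  have hχ : ∀ a b, χ (edgeVar a b) = (y 0 + y 1) a b := by
    have hlt : ∀ a b, a < b → χ (edgeVar a b) = (y 0 + y 1) a b := by
      intro a b hab
      simp [χ, y, ψ, edgeVar_of_lt hab, Fin.sum_univ_two]
    intro a b
    rcases lt_trichotomy a b with h | rfl | h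
    · exact hlt a b h
    · simp [y, edgeVar]
    · rw [edgeVar_comm, hlt b a h]
      simp only [y, Pi.add_apply, edgeVar_comm b a]
  have hmem : ∀ f, χ f = 0 → f ∈ secantIdeal (toricIdeal n) 2 := fun f hf =>
    (Ideal.Quotient.eq_zero_iff_mem (I := J)).1 hf
  have hsymm : ∀ k a b, y k a b = y k b a := fun k a b => by simp only [y, edgeVar_comm a b]
  have hminor : ∀ k a b c d, a ≠ b → a ≠ d → c ≠ b → c ≠ d →
      y k a b * y k c d - y k a d * y k c b = 0 := by
    intro k a b c d h1 h2 h3 h4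
    simp only [y, ← map_mul, ← map_sub]
    exact Ideal.Quotient.eq_zero_iff_mem.2 (Ideal.mem_iSup_of_mem k
      (Ideal.mem_map_of_mem _ (minor_mem_toricIdeal h1 h2 h3 h4)))
  rintro f ((⟨r, c, h, rfl⟩ | ⟨i, j, h, rfl⟩) | ⟨g, hg, k, hk, rfl⟩)
  · refine Ideal.mem_sup_right (hmem _ ?_)
    have hm : ∀ k, ∀ a ∈ Set.range r, ∀ b ∈ Set.range c, ∀ a' ∈ Set.range r, ∀ b' ∈ Set.range c,
        y k a b * y k a' b' - y k a b' * y k a' b = 0 := by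
      rintro k _ ⟨a, rfl⟩ _ ⟨b, rfl⟩ _ ⟨a', rfl⟩ _ ⟨b', rfl⟩
      exact hminor k _ _ _ _ (h _ _) (h _ _) (h _ _) (h _ _)
    have hz := detForm_add_eq_zero (a₁ := r 0) (a₂ := r 1) (a₃ := r 2) (b₁ := c 0) (b₂ := c 1)
      (b₃ := c 2) (s := Set.range r) (t := Set.range c) (by simp) (by simp) (hm 0) (hm 1)
    rw [det_eq_detForm]
    simpa only [detForm, map_add, map_sub, map_mul, hχ] using hz
  · refine Ideal.mem_sup_right (hmem _ ?_)
    rw [masterPolynomial_eq_masterForm]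
    have hz := masterForm_add_eq_zero (hsymm 0) (hsymm 1) h.nodup (hminor 0) (hminor 1)
    simpa only [masterForm, map_add, map_sub, map_mul, hχ] using hz
  · refine Ideal.mem_sup_left ?_
    rw [pow_two]
    exact Ideal.mul_mem_mul (mem_toricIdeal_of_mem_offDiagonalMinors hg)
      (mem_toricIdeal_of_mem_offDiagonalMinors hk)

theorem finite_symbolicSquareBasis (n : ℕ) : (symbolicSquareBasis n).Finite := by
  have hminors : ∀ d, (offDiagonalMinors n d).Finite := by
    intro d
    have : Finite (Fin d ↪o Fin n) := Finite.of_injective _ DFunLike.coe_injective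
    refine (Set.finite_range fun p : (Fin d ↪o Fin n) × (Fin d ↪o Fin n) =>
      (Matrix.of fun a b => edgeVar (p.1 a) (p.2 b)).det).subset ?_
    rintro _ ⟨r, c, -, rfl⟩
    exact ⟨(r, c), rfl⟩
  refine ((hminors 3).union ?_).union ?_
  · refine (Set.finite_range fun p : (ZMod (2 * 1 + 1) → Fin n) × (ZMod (2 * 1 + 1) → Fin n) =>
      masterPolynomial (k := 1) p.1 p.2).subset ?_
    rintro _ ⟨i, j, -, rfl⟩
    exact ⟨(i, j), rfl⟩
  · refine (((hminors 2).prod (hminors 2)).image fun p => p.1 * p.2).subset ?_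
    rintro _ ⟨g, hg, h, hh, rfl⟩
    exact ⟨(g, h), ⟨hg, hh⟩, rfl⟩

/-! ### Leading monomials of the basis -/

/-- The elements `p`, `q`, `r`, `s` occur in this cyclic order, going around once. -/
def CyclicallyOrdered {α : Type*} [LT α] (p q r s : α) : Prop :=
  (p < q ∧ q < r ∧ r < s) ∨ (q < r ∧ r < s ∧ s < p) ∨ (r < s ∧ s < p ∧ p < q) ∨
    (s < p ∧ p < q ∧ q < r)

theorem CyclicallyOrdered.map {α β : Type*} [Preorder α] [Preorder β] {f : α → β}
    (hf : StrictMono f) {p q r s : α} (h : CyclicallyOrdered p q r s) :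
    CyclicallyOrdered (f p) (f q) (f r) (f s) := by
  rcases h with h | h | h | h
  · exact .inl ⟨hf h.1, hf h.2.1, hf h.2.2⟩
  · exact .inr (.inl ⟨hf h.1, hf h.2.1, hf h.2.2⟩)
  · exact .inr (.inr (.inl ⟨hf h.1, hf h.2.1, hf h.2.2⟩))
  · exact .inr (.inr (.inr ⟨hf h.1, hf h.2.1, hf h.2.2⟩))

theorem cyclicallyOrdered_add (s i j k l : Fin 6) (hij : i < j) (hjk : j < k) (hkl : k < l) :
    CyclicallyOrdered (i + s) (j + s) (k + s) (l + s) := by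
  unfold CyclicallyOrdered
  revert s i j k l
  decide +kernel

theorem IsCircular.cross_lt_of_cyclicallyOrdered {n : ℕ} {m : MonomialOrder (Edge n)}
    (hm : IsCircular m) {p q r s : Fin n} (h : CyclicallyOrdered p q r s) :
    m.toSyn (edgeExp p r) + m.toSyn (edgeExp q s) <
      m.toSyn (edgeExp p q) + m.toSyn (edgeExp r s) ∧
    m.toSyn (edgeExp p r) + m.toSyn (edgeExp q s) <
      m.toSyn (edgeExp p s) + m.toSyn (edgeExp q r) := by
  simp only [← map_add]
  have c := edgeExp_comm (n := n)
  rcases h with ⟨h1, h2, h3⟩ | ⟨h1, h2, h3⟩ | ⟨h1, h2, h3⟩ | ⟨h1, h2, h3⟩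
  · exact hm.cross_lt h1 h2 h3
  · have := hm.cross_lt h1 h2 h3
    rw [c r p, add_comm (edgeExp q s), c s p, c q p] at this
    rw [add_comm (edgeExp p s)]
    exact this.symm
  · have := hm.cross_lt h1 h2 h3
    rw [c r p, c s q, add_comm (edgeExp r s), c s p, c r q, add_comm (edgeExp q r)] at this
    exact this
  · have := hm.cross_lt h1 h2 h3
    rw [c s q, add_comm (edgeExp q s), c s p, c s r, add_comm (edgeExp r s)] at this
    exact this.symm

/-- A sequence of six vertices in cyclic order. -/
def IsCyclic {n : ℕ} (v : Fin 6 → Fin n) : Prop :=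
  ∀ i j k l, i < j → j < k → k < l → CyclicallyOrdered (v i) (v j) (v k) (v l)

theorem isCyclic_of_strictMono {n : ℕ} {p : Fin 6 → Fin n} (hp : StrictMono p) (s : Fin 6) :
    IsCyclic fun i => p (i + s) :=
  fun i j k l hij hjk hkl => (cyclicallyOrdered_add s i j k l hij hjk hkl).map hp

theorem edgeVar_mul_mul {n : ℕ} {a b c d e f : Fin n} (h1 : a ≠ b) (h2 : c ≠ d) (h3 : e ≠ f) :
    edgeVar a b * edgeVar c d * edgeVar e f =
      monomial (edgeExp a b + edgeExp c d + edgeExp e f) 1 := by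
  rw [edgeVar_eq_monomial h1, edgeVar_eq_monomial h2, edgeVar_eq_monomial h3, monomial_mul,
    monomial_mul, mul_one, mul_one]

/-- The columns are listed in reverse so that the diagonal term is the parallel matching. Every
other term is reached from it by replacing, one at a time, a noncrossing pair by the crossing pair
on the same four vertices, which lowers the monomial. -/
theorem degree_detForm {n : ℕ} {m : MonomialOrder (Edge n)} (hm : IsCircular m)
    {v : Fin 6 → Fin n} (hv : IsCyclic v) (hinj : Function.Injective v) :
    detForm edgeVar edgeVar edgeVar (v 0) (v 1) (v 2) (v 5) (v 4) (v 3) ≠ 0 ∧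
    m.degree (detForm edgeVar edgeVar edgeVar (v 0) (v 1) (v 2) (v 5) (v 4) (v 3)) =
      edgeExp (v 0) (v 5) + edgeExp (v 1) (v 4) + edgeExp (v 2) (v 3) := by
  have hne : ∀ {i j : Fin 6}, i ≠ j → v i ≠ v j := fun h => hinj.ne h
  have C := fun i j k l h1 h2 h3 =>
    (hm.cross_lt_of_cyclicallyOrdered (hv i j k l h1 h2 h3)).2
  have c1 := C 0 1 4 5 (by decide) (by decide) (by decide)
  have c2 := C 1 2 3 4 (by decide) (by decide) (by decide)
  have c3 := C 1 2 3 5 (by decide) (by decide) (by decide)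
  have c4 := C 0 1 3 5 (by decide) (by decide) (by decide)
  have c5 := C 0 1 3 4 (by decide) (by decide) (by decide)
  have l1 : m.toSyn (edgeExp (v 0) (v 5) + edgeExp (v 1) (v 3) + edgeExp (v 2) (v 4)) <
      m.toSyn (edgeExp (v 0) (v 5) + edgeExp (v 1) (v 4) + edgeExp (v 2) (v 3)) := by
    simp only [map_add]
    have := add_lt_add_right c2 (m.toSyn (edgeExp (v 0) (v 5)))
    simpa only [add_assoc] using this
  have l2 : m.toSyn (edgeExp (v 0) (v 4) + edgeExp (v 1) (v 5) + edgeExp (v 2) (v 3)) <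
      m.toSyn (edgeExp (v 0) (v 5) + edgeExp (v 1) (v 4) + edgeExp (v 2) (v 3)) := by
    simp only [map_add]
    exact add_lt_add_left c1 _
  have l3 : m.toSyn (edgeExp (v 0) (v 4) + edgeExp (v 1) (v 3) + edgeExp (v 2) (v 5)) <
      m.toSyn (edgeExp (v 0) (v 5) + edgeExp (v 1) (v 4) + edgeExp (v 2) (v 3)) := by
    refine lt_trans ?_ l2
    simp only [map_add]
    have := add_lt_add_right c3 (m.toSyn (edgeExp (v 0) (v 4)))
    simpa only [add_assoc] using this
  have l4 : m.toSyn (edgeExp (v 0) (v 3) + edgeExp (v 1) (v 5) + edgeExp (v 2) (v 4)) <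
      m.toSyn (edgeExp (v 0) (v 5) + edgeExp (v 1) (v 4) + edgeExp (v 2) (v 3)) := by
    refine lt_trans ?_ l1
    simp only [map_add]
    exact add_lt_add_left c4 _
  have l5 : m.toSyn (edgeExp (v 0) (v 3) + edgeExp (v 1) (v 4) + edgeExp (v 2) (v 5)) <
      m.toSyn (edgeExp (v 0) (v 5) + edgeExp (v 1) (v 4) + edgeExp (v 2) (v 3)) := by
    refine lt_trans ?_ l3
    simp only [map_add]
    exact add_lt_add_left c5 _
  refine degree_of_sub_monomial m (c := (1 : ℂ)) one_ne_zero (h := _) ?_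
    (lt_of_mem_support_add (lt_of_mem_support_monomial (-1) l1)
      (lt_of_mem_support_add (lt_of_mem_support_monomial (-1) l2)
      (lt_of_mem_support_add (lt_of_mem_support_monomial 1 l3)
      (lt_of_mem_support_add (lt_of_mem_support_monomial 1 l4)
      (lt_of_mem_support_monomial (-1) l5)))))
  simp only [map_neg, ← edgeVar_mul_mul (hne (show (0 : Fin 6) ≠ 5 by decide))
    (hne (show (1 : Fin 6) ≠ 4 by decide)) (hne (show (2 : Fin 6) ≠ 3 by decide)),
    ← edgeVar_mul_mul (hne (show (0 : Fin 6) ≠ 5 by decide))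
    (hne (show (1 : Fin 6) ≠ 3 by decide)) (hne (show (2 : Fin 6) ≠ 4 by decide)),
    ← edgeVar_mul_mul (hne (show (0 : Fin 6) ≠ 4 by decide))
    (hne (show (1 : Fin 6) ≠ 5 by decide)) (hne (show (2 : Fin 6) ≠ 3 by decide)),
    ← edgeVar_mul_mul (hne (show (0 : Fin 6) ≠ 4 by decide))
    (hne (show (1 : Fin 6) ≠ 3 by decide)) (hne (show (2 : Fin 6) ≠ 5 by decide)),
    ← edgeVar_mul_mul (hne (show (0 : Fin 6) ≠ 3 by decide))
    (hne (show (1 : Fin 6) ≠ 5 by decide)) (hne (show (2 : Fin 6) ≠ 4 by decide)),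
    ← edgeVar_mul_mul (hne (show (0 : Fin 6) ≠ 3 by decide))
    (hne (show (1 : Fin 6) ≠ 4 by decide)) (hne (show (2 : Fin 6) ≠ 5 by decide))]
  unfold detForm
  ring

/-- The swapped pairs are the neighbours on the circle that the leading matching does not join. The
other seven terms are again reached by successive crossings. -/
theorem degree_masterForm {n : ℕ} {m : MonomialOrder (Edge n)} (hm : IsCircular m)
    {v : Fin 6 → Fin n} (hv : IsCyclic v) (hinj : Function.Injective v) :
    masterForm edgeVar edgeVar edgeVar (v 0) (v 5) (v 2) (v 1) (v 4) (v 3) ≠ 0 ∧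
    m.degree (masterForm edgeVar edgeVar edgeVar (v 0) (v 5) (v 2) (v 1) (v 4) (v 3)) =
      edgeExp (v 0) (v 1) + edgeExp (v 2) (v 3) + edgeExp (v 4) (v 5) := by
  have hne : ∀ {i j : Fin 6}, i ≠ j → v i ≠ v j := fun h => hinj.ne h
  have C := fun i j k l h1 h2 h3 => hm.cross_lt_of_cyclicallyOrdered (hv i j k l h1 h2 h3)
  have c1 := (C 0 1 2 3 (by decide) (by decide) (by decide)).1
  have c2 := (C 2 3 4 5 (by decide) (by decide) (by decide)).1
  have c3 := (C 0 1 4 5 (by decide) (by decide) (by decide)).1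
  have c4 := (C 1 3 4 5 (by decide) (by decide) (by decide)).1
  have c5 := (C 1 2 3 5 (by decide) (by decide) (by decide)).2
  have c6 := (C 0 2 3 4 (by decide) (by decide) (by decide)).2
  have c7 := (C 1 2 4 5 (by decide) (by decide) (by decide)).2
  set E := fun i j : Fin 6 => edgeExp (v i) (v j) with hE
  have shift : ∀ {a b c d : Edge n →₀ ℕ} (e : Edge n →₀ ℕ),
      m.toSyn a + m.toSyn b < m.toSyn c + m.toSyn d → ∀ {w w' : Edge n →₀ ℕ},
      w = a + b + e → w' = c + d + e → m.toSyn w < m.toSyn w' := by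
    rintro a b c d e h _ _ rfl rfl
    simp only [map_add]
    exact add_lt_add_left h _
  have comm : ∀ i j, E i j = E j i := fun i j => edgeExp_comm _ _
  have l1 : m.toSyn (E 0 2 + E 1 3 + E 4 5) < m.toSyn (E 0 1 + E 2 3 + E 4 5) :=
    shift (E 4 5) c1 rfl rfl
  have l2 : m.toSyn (E 0 1 + E 2 4 + E 3 5) < m.toSyn (E 0 1 + E 2 3 + E 4 5) :=
    shift (E 0 1) c2 (by simp only [E]; abel) (by simp only [E]; abel)
  have l3 : m.toSyn (E 1 5 + E 2 3 + E 0 4) < m.toSyn (E 0 1 + E 2 3 + E 4 5) :=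
    shift (E 2 3) c3 (by simp only [E]; abel) (by simp only [E]; abel)
  have l4 : m.toSyn (E 0 2 + E 1 4 + E 3 5) < m.toSyn (E 0 1 + E 2 3 + E 4 5) :=
    (shift (w' := E 0 2 + E 1 3 + E 4 5) (E 0 2) c4 (by simp only [E]; abel)
      (by simp only [E]; abel)).trans l1
  have l5 : m.toSyn (E 2 5 + E 1 3 + E 0 4) < m.toSyn (E 0 1 + E 2 3 + E 4 5) :=
    (shift (w' := E 1 5 + E 2 3 + E 0 4) (E 0 4) c5 (by simp only [E]; abel)
      (by simp only [E])).trans l3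
  have l6 : m.toSyn (E 1 5 + E 2 4 + E 0 3) < m.toSyn (E 0 1 + E 2 3 + E 4 5) :=
    (shift (w' := E 1 5 + E 2 3 + E 0 4) (E 1 5) c6 (by simp only [E]; abel)
      (by simp only [E]; abel)).trans l3
  have l7 : m.toSyn (E 2 5 + E 1 4 + E 0 3) < m.toSyn (E 0 1 + E 2 3 + E 4 5) :=
    (shift (w' := E 1 5 + E 2 4 + E 0 3) (E 0 3) c7 (by simp only [E]; abel)
      (by simp only [E])).trans l6
  have mono : ∀ i j k l p q : Fin 6, i ≠ j → k ≠ l → p ≠ q → monomial (E i j + E k l + E p q) 1 =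
      edgeVar (v i) (v j) * edgeVar (v k) (v l) * edgeVar (v p) (v q) :=
    fun i j k l p q h1 h2 h3 => (edgeVar_mul_mul (hne h1) (hne h2) (hne h3)).symm
  refine degree_of_sub_monomial m (u := E 0 1 + E 2 3 + E 4 5) (c := (1 : ℂ)) one_ne_zero
    (h := _) ?_
    (lt_of_mem_support_add (lt_of_mem_support_monomial (-1) l1)
      (lt_of_mem_support_add (lt_of_mem_support_monomial (-1) l2)
      (lt_of_mem_support_add (lt_of_mem_support_monomial (-1) l3)
      (lt_of_mem_support_add (lt_of_mem_support_monomial 1 l4)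
      (lt_of_mem_support_add (lt_of_mem_support_monomial 1 l5)
      (lt_of_mem_support_add (lt_of_mem_support_monomial 1 l6)
      (lt_of_mem_support_monomial (-1) l7)))))))
  rw [map_neg, map_neg, map_neg, map_neg]
  repeat rw [mono _ _ _ _ _ _ (by decide) (by decide) (by decide)]
  have c := edgeVar_comm (n := n)
  unfold masterForm
  rw [c (v 5) (v 1), c (v 5) (v 2), c (v 1) (v 3), c (v 4) (v 0), c (v 3) (v 0), c (v 3) (v 5),
    c (v 1) (v 4)]
  ring

/-- Taking one end of each edge as a row, suitably chosen, makes the other term of the minor the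
crossing pair. Nested edges appear on the antidiagonal, hence the change of sign there. -/
theorem exists_offDiagonalMinor_two {n : ℕ} {m : MonomialOrder (Edge n)} (hm : IsCircular m)
    {e f : Edge n} (h : Noncrossing e f) :
    ∃ g ∈ offDiagonalMinors n 2, g ≠ 0 ∧
      m.degree g = Finsupp.single e 1 + Finsupp.single f 1 := by
  wlog hef : e.1.1 < f.1.1 generalizing e f
  · rw [add_comm]
    refine this h.symm ?_
    have h1 := e.2
    have h2 := f.2
    unfold Noncrossing at h
    rcases h with h | h | h | h <;> order
  have h2 := f.2
  have h1 := e.2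
  rw [← edgeExp_edge, ← edgeExp_edge]
  have mk : ∀ {p q r s : Fin n}, p < q → r < s → p ≠ r → p ≠ s → q ≠ r → q ≠ s →
      edgeVar p r * edgeVar q s - edgeVar p s * edgeVar q r ∈ offDiagonalMinors n 2 := by
    intro p q r s hpq hrs h1 h2 h3 h4
    refine ⟨OrderEmbedding.ofStrictMono ![p, q] (by simpa [Fin.strictMono_iff_lt_succ] using hpq),
      OrderEmbedding.ofStrictMono ![r, s] (by simpa [Fin.strictMono_iff_lt_succ] using hrs), ?_, ?_⟩
    · simp [Fin.forall_fin_two, h1, h2, h3, h4]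
    · simp [Matrix.det_fin_two]
  have main : ∀ {a b c d a' b' c' d' : Fin n}, a ≠ b → c ≠ d → a' ≠ b' → c' ≠ d' →
      m.toSyn (edgeExp a' b' + edgeExp c' d') < m.toSyn (edgeExp a b + edgeExp c d) →
      edgeVar a b * edgeVar c d - edgeVar a' b' * edgeVar c' d' ≠ 0 ∧
      m.degree (edgeVar a b * edgeVar c d - edgeVar a' b' * edgeVar c' d') =
        edgeExp a b + edgeExp c d := by
    intro a b c d a' b' c' d' h1 h2 h3 h4 hlt
    refine degree_of_sub_monomial m (c := (1 : ℂ)) one_ne_zero (h := _) ?_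
      (lt_of_mem_support_monomial (-1) hlt)
    rw [edgeVar_eq_monomial h1, edgeVar_eq_monomial h2, edgeVar_eq_monomial h3,
      edgeVar_eq_monomial h4, monomial_mul, monomial_mul, mul_one, map_neg, sub_eq_add_neg]
  unfold Noncrossing at h
  have h' : e.1.2 < f.1.1 ∨ f.1.2 < e.1.2 := by
    rcases h with h | h | h | h
    · exact .inl h
    · order
    · exact .inr h.2
    · order
  rcases h' with h | h
  · have hc := (hm.cross_lt h1 h h2).1
    refine ⟨_, mk (p := e.1.1) (q := f.1.2) (r := e.1.2) (s := f.1.1) (by order) (by order)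
      (by order) (by order) (by order) (by order), ?_⟩
    rw [edgeVar_comm f.1.2 f.1.1, edgeVar_comm f.1.2 e.1.2]
    exact main (by order) (by order) (by order) (by order) hc
  · have hc := (hm.cross_lt hef h2 h).2
    have hg := main (a := e.1.1) (b := e.1.2) (c := f.1.1) (d := f.1.2) (by order) (by order)
      (by order) (by order) hc
    refine ⟨_, mk (p := e.1.1) (q := f.1.1) (r := f.1.2) (s := e.1.2) (by order) (by order)
      (by order) (by order) (by order) (by order), ?_⟩
    rw [← neg_sub, neg_ne_zero, MonomialOrder.degree_neg]
    exact hg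

theorem detForm_mem_offDiagonalMinors {n : ℕ} {p q r s t u : Fin n} (hpq : p < q) (hqr : q < r)
    (hst : s < t) (htu : t < u) (h : ∀ x ∈ [p, q, r], ∀ y ∈ [s, t, u], x ≠ y) :
    detForm edgeVar edgeVar edgeVar p q r s t u ∈ offDiagonalMinors n 3 := by
  refine ⟨OrderEmbedding.ofStrictMono ![p, q, r] ?_, OrderEmbedding.ofStrictMono ![s, t, u] ?_,
    ?_, ?_⟩
  · simp [Fin.strictMono_iff_lt_succ, Fin.forall_fin_two, hpq, hqr]
  · simp [Fin.strictMono_iff_lt_succ, Fin.forall_fin_two, hst, htu]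
  · intro a b
    refine h _ ?_ _ ?_
    · fin_cases a <;> simp
    · fin_cases b <;> simp
  · rw [det_eq_detForm]
    rfl

/-- Subtraction in `Fin n` is distance around the circle from `z`; the three alternatives say where
the numbering wraps. -/
theorem sub_lt_sub_of_cyclic {n : ℕ} {x y z : Fin n}
    (h : (z ≤ x ∧ x < y) ∨ (x < y ∧ y < z) ∨ (y < z ∧ z ≤ x)) : x - z < y - z := by
  have hx := x.2
  have hy := y.2
  have hz := z.2
  have key : ∀ w : Fin n, ((w - z : Fin n) : ℕ) = if (z : ℕ) ≤ w then (w : ℕ) - z else n + w - z := by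
    intro w
    have hw := w.2
    rw [Fin.sub_def]
    show (n - z + w) % n = _
    split_ifs with h
    · rw [show n - (z : ℕ) + w = (w - z) + n by omega, Nat.add_mod_right, Nat.mod_eq_of_lt (by omega)]
    · rw [Nat.mod_eq_of_lt (by omega)]; omega
  simp only [Fin.lt_def, Fin.le_def] at h ⊢
  rw [key, key]
  split_ifs <;> omega

theorem masterForm_mem_masterPolynomials {n : ℕ} {p : Fin 6 → Fin n} (hp : StrictMono p)
    (s : Fin 6) {v : Fin 6 → Fin n} (hv : v = fun i => p (i + s)) :
    masterForm edgeVar edgeVar edgeVar (v 0) (v 5) (v 2) (v 1) (v 4) (v 3) ∈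
      masterPolynomials n 1 := by
  have hlt : ∀ a b : Fin 6, a < b → v a - v 0 < v b - v 0 := by
    intro a b hab
    have h6 : ∀ s a b : Fin 6, a < b → ((0 + s ≤ a + s ∧ a + s < b + s) ∨
        (a + s < b + s ∧ b + s < 0 + s) ∨ (b + s < 0 + s ∧ 0 + s ≤ a + s)) := by
      decide +kernel
    subst hv
    apply sub_lt_sub_of_cyclic
    rcases h6 s a b hab with h | h | h
    · exact .inl ⟨hp.monotone h.1, hp h.2⟩
    · exact .inr (.inl ⟨hp h.1, hp h.2⟩)
    · exact .inr (.inr ⟨hp h.1, hp.monotone h.2⟩)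
  have hval : ∀ l : ZMod (2 * 1 + 1), l.val < 3 := fun l => ZMod.val_lt l
  -- The six vertices alternate: `i_l` is `v (2l)` and `j_l` is `v (2l + 1)`.
  refine ⟨fun l => v ⟨2 * l.val, by have := hval l; omega⟩,
    fun l => v ⟨2 * l.val + 1, by have := hval l; omega⟩, ⟨fun l => ?_, fun l l' hl => ?_,
      fun l => ?_⟩, ?_⟩
  · exact (hlt _ _ (Fin.lt_def.2 (Nat.lt_succ_self _))).le
  · exact hlt _ _ (Fin.lt_def.2 (by show 2 * l.val + 1 < 2 * l'.val; omega))
  · have e : l + ((1 : ℕ) : ZMod (2 * 1 + 1)) - 1 = l := by push_cast; ring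
    intro h
    simp only [e] at h
    exact (hlt ⟨2 * l.val, by have := hval l; omega⟩ ⟨2 * l.val + 1, by have := hval l; omega⟩
      (Fin.lt_def.2 (Nat.lt_succ_self _))).ne (by rw [h])
  · rw [masterPolynomial_eq_masterForm]
    rfl

/-- Every noncrossing perfect matching of six vertices is the leading monomial of an off-diagonal
`3 × 3` minor or of a master polynomial. -/
theorem exists_degree_eq_noncrossing_matching {n : ℕ} {m : MonomialOrder (Edge n)}
    (hm : IsCircular m) {p : Fin 6 → Fin n} (hp : StrictMono p) {u : Edge n →₀ ℕ}
    (hu : u = edgeExp (p 0) (p 1) + edgeExp (p 2) (p 3) + edgeExp (p 4) (p 5) ∨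
      u = edgeExp (p 1) (p 2) + edgeExp (p 3) (p 4) + edgeExp (p 5) (p 0) ∨
      u = edgeExp (p 0) (p 5) + edgeExp (p 1) (p 4) + edgeExp (p 2) (p 3) ∨
      u = edgeExp (p 1) (p 0) + edgeExp (p 2) (p 5) + edgeExp (p 3) (p 4) ∨
      u = edgeExp (p 2) (p 1) + edgeExp (p 3) (p 0) + edgeExp (p 4) (p 5)) :
    ∃ g ∈ offDiagonalMinors n 3 ∪ masterPolynomials n 1, g ≠ 0 ∧ m.degree g = u := by
  have hinj : ∀ s : Fin 6, Function.Injective fun i => p (i + s) := fun s =>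
    hp.injective.comp (add_left_injective s)
  have hlt : ∀ {i j : Fin 6}, i < j → p i < p j := fun h => hp h
  have D := fun s => degree_detForm hm (isCyclic_of_strictMono hp s) (hinj s)
  have M := fun s => degree_masterForm hm (isCyclic_of_strictMono hp s) (hinj s)
  -- The columns in `degree_detForm` differ from increasing order by an odd permutation in each of
  -- the three rotations used, so the actual minor is the negative of that form.
  have neg : ∀ {f g : EdgeRing n}, g ∈ offDiagonalMinors n 3 → f = -g → f ≠ 0 ∧ m.degree f = u →
      ∃ g ∈ offDiagonalMinors n 3 ∪ masterPolynomials n 1, g ≠ 0 ∧ m.degree g = u := by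
    rintro _ g hg rfl hf
    rw [neg_ne_zero, MonomialOrder.degree_neg] at hf
    exact ⟨g, .inl hg, hf⟩
  rcases hu with rfl | rfl | rfl | rfl | rfl
  · exact ⟨_, .inr (masterForm_mem_masterPolynomials hp 0 rfl), M 0⟩
  · exact ⟨_, .inr (masterForm_mem_masterPolynomials hp 1 rfl), M 1⟩
  · refine neg (detForm_mem_offDiagonalMinors (p := p 0) (q := p 1) (r := p 2) (s := p 3)
      (t := p 4) (u := p 5) (hlt (by decide)) (hlt (by decide)) (hlt (by decide)) (hlt (by decide))
      ?_) ?_ (D 0)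
    · simp [hp.injective.eq_iff]
    · show detForm _ _ _ (p 0) (p 1) (p 2) (p 5) (p 4) (p 3) = _
      unfold detForm
      ring
  · refine neg (detForm_mem_offDiagonalMinors (p := p 1) (q := p 2) (r := p 3) (s := p 0)
      (t := p 4) (u := p 5) (hlt (by decide)) (hlt (by decide)) (hlt (by decide)) (hlt (by decide))
      ?_) ?_ (D 1)
    · simp [hp.injective.eq_iff]
    · show detForm _ _ _ (p 1) (p 2) (p 3) (p 0) (p 5) (p 4) = _
      unfold detForm
      ring
  · refine neg (detForm_mem_offDiagonalMinors (p := p 2) (q := p 3) (r := p 4) (s := p 0)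
      (t := p 1) (u := p 5) (hlt (by decide)) (hlt (by decide)) (hlt (by decide)) (hlt (by decide))
      ?_) ?_ (D 2)
    · simp [hp.injective.eq_iff]
    · show detForm _ _ _ (p 2) (p 3) (p 4) (p 1) (p 0) (p 5) = _
      unfold detForm
      ring

/-- With the smaller ends ordered, each pair of edges is side by side or nested. This fixes the
order of all six ends and gives exactly the five noncrossing matchings. -/
theorem exists_degree_eq_triangle_of_lt {n : ℕ} {m : MonomialOrder (Edge n)} (hm : IsCircular m)
    {e f g : Edge n} (hef : Noncrossing e f) (hfg : Noncrossing f g) (heg : Noncrossing e g)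
    (h1 : e.1.1 < f.1.1) (h2 : f.1.1 < g.1.1) :
    ∃ q ∈ offDiagonalMinors n 3 ∪ masterPolynomials n 1, q ≠ 0 ∧
      m.degree q = Finsupp.single e 1 + Finsupp.single f 1 + Finsupp.single g 1 := by
  have he := e.2
  have hf := f.2
  have hg := g.2
  have split : ∀ {a b : Edge n}, Noncrossing a b → a.1.1 < b.1.1 →
      a.1.2 < b.1.1 ∨ b.1.2 < a.1.2 := by
    intro a b hab hlt
    have ha := a.2
    have hb := b.2
    rcases hab with h | h | h | h
    · exact .inl h
    · order
    · exact .inr h.2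
    · order
  have smono : ∀ {a b c d x y : Fin n}, a < b → b < c → c < d → d < x → x < y →
      StrictMono ![a, b, c, d, x, y] := by
    intro a b c d x y h1 h2 h3 h4 h5
    rw [Fin.strictMono_iff_lt_succ]
    intro i
    fin_cases i <;> assumption
  simp only [← edgeExp_edge]
  have c := edgeExp_comm (n := n)
  rcases split hef h1 with a | a <;> rcases split hfg h2 with b | b
  · exact exists_degree_eq_noncrossing_matching hm (smono he a hf b hg) (.inl rfl)
  · refine exists_degree_eq_noncrossing_matching hm (smono he a h2 hg b)
      (.inr (.inr (.inr (.inl ?_))))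
    rw [c e.1.1]; rfl
  · rcases split heg (h1.trans h2) with d | d
    · refine exists_degree_eq_noncrossing_matching hm (smono h1 hf a d hg)
        (.inr (.inr (.inr (.inr ?_))))
      rw [c e.1.1, c f.1.1, add_comm (edgeExp e.1.2 _)]
      show _ = edgeExp f.1.2 f.1.1 + edgeExp e.1.2 e.1.1 + _
      rfl
    · refine exists_degree_eq_noncrossing_matching hm (smono h1 hf b hg d) (.inr (.inl ?_))
      rw [c e.1.1, add_assoc, add_comm]
      rfl
  · exact exists_degree_eq_noncrossing_matching hm (smono h1 h2 hg b a)
      (.inr (.inr (.inl rfl)))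

theorem exists_degree_eq_triangle {n : ℕ} {m : MonomialOrder (Edge n)} (hm : IsCircular m)
    {e f g : Edge n} (hef : Noncrossing e f) (hfg : Noncrossing f g) (heg : Noncrossing e g) :
    ∃ q ∈ offDiagonalMinors n 3 ∪ masterPolynomials n 1, q ≠ 0 ∧
      m.degree q = Finsupp.single e 1 + Finsupp.single f 1 + Finsupp.single g 1 := by
  have hne : ∀ {a b : Edge n}, Noncrossing a b → a.1.1 < b.1.1 ∨ b.1.1 < a.1.1 := by
    intro a b h
    have ha := a.2
    have hb := b.2
    rcases h with h | h | h | h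
    · left; order
    · right; order
    · exact .inl h.1
    · exact .inr h.1
  generalize hu : (Finsupp.single e 1 + Finsupp.single f 1 + Finsupp.single g 1 : Edge n →₀ ℕ) = u
  have main : ∀ {a b c : Edge n}, Noncrossing a b → Noncrossing b c → Noncrossing a c →
      a.1.1 < b.1.1 → b.1.1 < c.1.1 →
      (Finsupp.single a 1 + Finsupp.single b 1 + Finsupp.single c 1 : Edge n →₀ ℕ) = u →
      ∃ q ∈ offDiagonalMinors n 3 ∪ masterPolynomials n 1, q ≠ 0 ∧ m.degree q = u := by
    rintro a b c hab hbc hac h1 h2 rfl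
    exact exists_degree_eq_triangle_of_lt hm hab hbc hac h1 h2
  rcases hne hef with h1 | h1 <;> rcases hne hfg with h2 | h2 <;> rcases hne heg with h3 | h3
  · exact main hef hfg heg h1 h2 hu
  · order
  · exact main heg hfg.symm hef h3 h2 (by rw [← hu]; abel)
  · exact main heg.symm hef hfg.symm h3 h1 (by rw [← hu]; abel)
  · exact main hef.symm heg hfg h1 h3 (by rw [← hu]; abel)
  · exact main hfg heg.symm hef.symm h2 h3 (by rw [← hu]; abel)
  · order
  · exact main hfg.symm hef.symm heg.symm h2 h1 (by rw [← hu]; abel)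

/-- The leading monomial of a polynomial that lies in `I_n` together with its derivatives is
divisible by the leading monomial of an element of the basis. -/
theorem exists_degree_le_of_mem_differentialSquare {n : ℕ} {m : MonomialOrder (Edge n)}
    (hm : IsCircular m) {f : EdgeRing n} (hf : f ∈ differentialSquare (toricIdeal n))
    (h0 : f ≠ 0) :
    ∃ g ∈ symbolicSquareBasis n, g ≠ 0 ∧ m.degree g ≤ m.degree f := by
  have hsupp := m.degree_mem_support h0
  have hmax : ∀ w ∈ f.support, m.toSyn w ≤ m.toSyn (m.degree f) := fun w hw => m.le_degree hw
  -- The graph here has the edges of `K_n` as vertices and the noncrossing pairs as edges; the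
  -- second hypothesis comes from the partial derivatives of `f`.
  rcases exists_two_edges_or_triangle (r := Noncrossing) not_noncrossing_self
    (fun h => h.symm) (exists_noncrossing_of_mem_toricIdeal hm hf.1 hsupp hmax)
    (fun i hi => by
      obtain ⟨h1, h2⟩ := sub_single_mem_support_pderiv hsupp hmax hi
      exact exists_noncrossing_of_mem_toricIdeal hm (hf.2 i) h1 h2) with
    ⟨a, b, c, d, hab, hcd, hle⟩ | ⟨a, b, c, hab, hbc, hac, hle⟩
  · obtain ⟨g, hg, hg0, hgd⟩ := exists_offDiagonalMinor_two hm hab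
    obtain ⟨k, hk, hk0, hkd⟩ := exists_offDiagonalMinor_two hm hcd
    refine ⟨g * k, .inr ⟨g, hg, k, hk, rfl⟩, mul_ne_zero hg0 hk0, ?_⟩
    rwa [m.degree_mul hg0 hk0, hgd, hkd]
  · obtain ⟨g, hg, hg0, hgd⟩ := exists_degree_eq_triangle hm hab hbc hac
    exact ⟨g, .inl hg, hg0, hgd ▸ hle⟩

/-! ### Equality of the symbolic and differential squares -/

theorem span_symbolicSquareBasis (n : ℕ) :
    Ideal.span (symbolicSquareBasis n) = differentialSquare (toricIdeal n) := by
  obtain ⟨m, hm⟩ := exists_isBlockOrder (edgeClass (n := n))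
  exact span_eq_of_degree_le m ((symbolicSquareBasis_subset_symbolicPower n).trans
    (symbolicPower_two_le_differentialSquare _))
    fun f hf h0 => exists_degree_le_of_mem_differentialSquare hm hf h0

theorem symbolicPower_two_eq_differentialSquare (n : ℕ) :
    symbolicPower (toricIdeal n) 2 = differentialSquare (toricIdeal n) :=
  le_antisymm (symbolicPower_two_le_differentialSquare _) (by
    rw [← span_symbolicSquareBasis]
    exact Ideal.span_le.2 (symbolicSquareBasis_subset_symbolicPower n))

end Hypersimplex

end

theorem mainTheorem3 (n : ℕ) :
    (∀ m : MonomialOrder (Hypersimplex.Edge n), Hypersimplex.IsCircular m →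
      Hypersimplex.IsGroebnerBasis m (Hypersimplex.symbolicSquareBasis n)
        (Hypersimplex.symbolicPower (Hypersimplex.toricIdeal n) 2)) ∧
    Hypersimplex.symbolicPower (Hypersimplex.toricIdeal n) 2 =
      Hypersimplex.toricIdeal n ^ 2 ⊔
        Hypersimplex.secantIdeal (Hypersimplex.toricIdeal n) 2 := by
  refine ⟨fun m hm => ?_, ?_⟩
  · exact Hypersimplex.isGroebnerBasis_of_degree_le m (Hypersimplex.finite_symbolicSquareBasis n)
      (Hypersimplex.symbolicSquareBasis_subset_symbolicPower n) fun f hf h0 =>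
        Hypersimplex.exists_degree_le_of_mem_differentialSquare hm
          (Hypersimplex.symbolicPower_two_le_differentialSquare _ hf) h0
  · rw [Hypersimplex.symbolicPower_two_eq_differentialSquare]
    refine le_antisymm ?_ (sup_le (Hypersimplex.sq_le_differentialSquare _)
      (Hypersimplex.secantIdeal_le_differentialSquare n))
    rw [← Hypersimplex.span_symbolicSquareBasis]
    exact Ideal.span_le.2 (Hypersimplex.symbolicSquareBasis_subset_sup n)
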